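/- Let $\ell(z)=-\log\big(p(x\mid z)\,p(z)\big)$, $z\in\mathbb R^d$, be the negative joint log-likelihood of a model with (measurable, everywhere positive) likelihood $p(x\mid\cdot)$ and prior probability density $p(\cdot)$, and let $\ell_{\rm like}(z)=-\log p(x\mid z)$. Consider the location-scale family $q_\lambda=\mathrm{Law}(Cu+m)$, where $u=(u_1,\dots,u_d)$ has i.i.d. components with $\mathbb E u_i=0$, $\mathbb E u_i^2=1$, $\mathbb E u_i^3=0$, $\mathbb E u_i^4=k_\varphi<\infty$ and a Lebesgue density of finite differential entropy. The parameters are either $\lambda=(m,s)\in\mathbb R^{2d}$ with $C=\mathrm{diag}(\phi(s_1),\dots,\phi(s_d))$ (mean-field), or $\lambda=(m,s,L)$ with $C=\mathrm{diag}(\phi(s_1),\dots,\phi(s_d))+L$, $L$ strictly lower triangular (Cholesky); here $\phi:\mathbb R\to(0,\infty)$ is twice differentiable, $1$-Lipschitz, and $\log\phi$ has an $L_\phi$-Lipschitz derivative. Write $T_\lambda(u)=Cu+m$, and let $$F(\lambda)=\mathbb E_{z\sim q_\lambda}\ell(z)-\mathbb H(q_\lambda),\qquad h(\lambda)=-\mathbb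 H(q_\lambda),\qquad F^*=\inf_\lambda F(\lambda),$$ with $\mathbb H$ the differential entropy. Assume: 1. $\ell$ is differentiable with $L_\ell$-Lipschitz gradient, and for some $L_s>0$, all $\lambda$ and all $i$, $\big|\mathbb E\,[\partial_i\ell(T_\lambda(u))\,u_i\,\phi''(s_i)]\big|\le L_s$. 2. $\ell_{\rm like}$ has a nonempty set $S$ of minimizers, and for some $\mu>0$, $\frac\mu2\,\mathrm{dist}(z,S)^2\le \ell_{\rm like}(z)-\ell^*_{\rm like}$ for all $z$, where $\ell_{\rm like}^*=\inf\ell_{\rm like}$. 3. $\bar z$ is a minimizer of $\ell$, and $\Delta<\infty$ satisfies $\|\bar z-z\|_2\le\Delta$ for every $z\in S$. Fix $M\ge1$ and $\lambda_0$, and run SGD with a fixed stepsize $\gamma$, $$\lambda_{t+1}=\lambda_t-\gamma\Big(\tfrac1M\sum_{m=1}^M\nabla_\lambda\,\ell\big(T_{\lambda}(u_{t,m})\big)\big|_{\lambda=\lambda_t}+\nabla h(\lambda_t)\Big),$$ where the $u_{t,m}$ are independent copies of $u$. Put $L_F=L_\ell+L_\phi+L_s$, $\delta=F(\lambda_0)-F^*$,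 $R=\mu\Delta^2+F^*-\ell^*_{\rm like}$, and $C(d,\varphi)=d+k_\varphi$ for the Cholesky family, $C(d,\varphi)=2k_\varphi\sqrt d+1$ for the mean-field family. Then $F$ is well defined (all energies and entropies are finite), bounded below, and differentiable with $L_F$-Lipschitz gradient. Moreover there is a universal constant $K>0$ such that for every $\epsilon>0$ there is a fixed stepsize $\gamma>0$ with $$\min_{0\le t\le T-1}\mathbb E\,\|\nabla F(\lambda_t)\|_2\le\epsilon$$ for all integers $T\ge1$ satisfying $$T\ \ge\ K\left(\frac{\delta^2L_FL_\ell^2\,C(d,\varphi)}{\mu M\epsilon^4}+\frac{\delta R\,L_FL_\ell^2\,C(d,\varphi)}{\mu M\epsilon^4}+\frac{\delta L_F}{\epsilon^2}\right).$$ If $\epsilon^2\le \delta L_\ell^2C(d,\varphi)/(\mu M)$, the condition $T\ge K\,(1+R/\delta)\,\delta^2L_FL_\ell^2C(d,\varphi)/(\mu M\epsilon^4)$ suffices; and for every such problem there is $c>0$, not depending on $\epsilon$ or $T$, such that for every $\epsilon>0$ the condition $T\ge c\,\delta^2L_FL_\ell^2C(d,\varphi)/(\mu M\epsilon^4)$ suffices.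 That is, $T=\mathcal O\big((F(\lambda_0)-F^*)^2L_FL_\ell^2C(d,\varphi)/(\mu M\epsilon^4)\big)$ iterations are enough. -/

import Mathlib

universe u

namespace BBVI

open MeasureTheory ProbabilityTheory

noncomputable section

/-- The Euclidean space `ℝᵈ`. -/
abbrev Vec (d : ℕ) : Type := EuclideanSpace ℝ (Fin d)

/-- The two location-scale families: diagonal scale matrices, and lower triangular ones. -/
inductive ScaleFamily : Type
  | meanField
  | cholesky

/-- The off-diagonal positions of the scale matrix that carry a free parameter: none for the
mean-field family, the strictly lower triangular ones for the Cholesky family. -/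
def ScaleFamily.offDiag (fam : ScaleFamily) (d : ℕ) : Finset (Fin d × Fin d) :=
  match fam with
  | .meanField => ∅
  | .cholesky => Finset.univ.filter fun p => p.2 < p.1

/-- The space `Λ` of variational parameters `(m, s)` (mean-field) or `(m, s, L)` (Cholesky), with
the Euclidean norm of all coordinates. With a nonlinear conditioner `s` ranges over `ℝᵈ`. -/
abbrev Param (fam : ScaleFamily) (d : ℕ) : Type :=
  EuclideanSpace ℝ (Fin d ⊕ Fin d ⊕ {p : Fin d × Fin d // p ∈ fam.offDiag d})

variable {fam : ScaleFamily} {d : ℕ}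

/-- The location `m`. -/
def location (l : Param fam d) : Vec d := WithLp.toLp 2 fun i => l (Sum.inl i)

/-- The unconstrained diagonal parameter `s i`. -/
def diagParam (l : Param fam d) (i : Fin d) : ℝ := l (Sum.inr (Sum.inl i))

/-- The scale matrix `C = diag(φ(s)) + L`, with `L = 0` for the mean-field family. -/
def scaleMatrix (φ : ℝ → ℝ) (l : Param fam d) : Matrix (Fin d) (Fin d) ℝ :=
  Matrix.of fun i j =>
    if i = j then φ (diagParam l i)
    else if h : (i, j) ∈ fam.offDiag d then l (Sum.inr (Sum.inr ⟨(i, j), h⟩))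
    else 0

/-- The location-scale reparameterization `u ↦ C u + m`. -/
def reparam (φ : ℝ → ℝ) (l : Param fam d) (u : Vec d) : Vec d :=
  WithLp.toLp 2 ((scaleMatrix φ l).mulVec u.ofLp) + location l

/-- The `d`-variate law with i.i.d. components of law `ν`. -/
def baseLaw (ν : Measure ℝ) (d : ℕ) : Measure (Vec d) :=
  (Measure.pi fun _ : Fin d => ν).map (WithLp.toLp 2)

/-- The variational distribution: the law of `C u + m` for `u` drawn from the base law. -/
def variational (φ : ℝ → ℝ) (ν : Measure ℝ) (l : Param fam d) : Measure (Vec d) :=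
  (baseLaw ν d).map (reparam φ l)

/-- Lebesgue log-density of a measure. -/
def logDensity {E : Type*} [MeasureSpace E] (q : Measure E) (z : E) : ℝ :=
  Real.log (q.rnDeriv volume z).toReal

/-- Differential entropy `-∫ log (dq/dz) dq`. -/
def diffEntropy {E : Type*} [MeasureSpace E] (q : Measure E) : ℝ :=
  -∫ z, logDensity q z ∂q

/-- `q` has a Lebesgue density and its differential entropy exists as a finite number. -/
def HasFiniteEntropy {E : Type*} [MeasureSpace E] (q : Measure E) : Prop :=
  q ≪ volume ∧ Integrable (logDensity q) q

/-- Negative log-likelihood `z ↦ -log p(x ∣ z)`. -/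
def negLogLik (lik : Vec d → ℝ) (z : Vec d) : ℝ := -Real.log (lik z)

/-- Negative joint log-likelihood `z ↦ -log (p(x ∣ z) p(z))`. -/
def negLogJoint (lik prior : Vec d → ℝ) (z : Vec d) : ℝ := -Real.log (lik z * prior z)

/-- The energy: expected negative joint log-likelihood under the variational distribution. -/
def energy (φ : ℝ → ℝ) (ν : Measure ℝ) (lik prior : Vec d → ℝ) (l : Param fam d) : ℝ :=
  ∫ z, negLogJoint lik prior z ∂(variational φ ν l)

/-- The entropic regularizer: the negative entropy of the variational distribution. -/
def entropicReg (φ : ℝ → ℝ) (ν : Measure ℝ) (l : Param fam d) : ℝ :=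
  -diffEntropy (variational φ ν l)

/-- The objective `F`, the negative evidence lower bound. -/
def negELBO (φ : ℝ → ℝ) (ν : Measure ℝ) (lik prior : Vec d → ℝ) (l : Param fam d) : ℝ :=
  energy φ ν lik prior l + entropicReg φ ν l

/-- The set of global minimizers. -/
def minimizers {E : Type*} (f : E → ℝ) : Set E := {z | ∀ w, f z ≤ f w}

/-- `L`-smoothness: differentiable with `L`-Lipschitz gradient. -/
def IsSmooth {E : Type*} [NormedAddCommGroup E] [InnerProductSpace ℝ E] [CompleteSpace E]
    (L : ℝ) (f : E → ℝ) : Prop :=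
  Differentiable ℝ f ∧ ∀ x y, ‖gradient f x - gradient f y‖ ≤ L * ‖x - y‖

/-- `μ`-quadratic growth; the distance to the set of minimizers is the distance of `z` to its
projection on that set. -/
structure QuadraticGrowth (μ : ℝ) (f : Vec d → ℝ) : Prop where
  pos : 0 < μ
  nonempty : (minimizers f).Nonempty
  growth : ∀ z, μ / 2 * Metric.infDist z (minimizers f) ^ 2 ≤ f z - ⨅ w, f w

/-- Law of one component of the base distribution: standardized, with vanishing third and finite
fourth moment, and with a density of finite differential entropy. -/
structure IsBaseComponent (ν : Measure ℝ) : Prop where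
  prob : IsProbabilityMeasure ν
  integrable_pow_four : Integrable (fun x : ℝ => x ^ 4) ν
  mean : ∫ x : ℝ, x ∂ν = 0
  second : ∫ x : ℝ, x ^ 2 ∂ν = 1
  third : ∫ x : ℝ, x ^ 3 ∂ν = 0
  entropy : HasFiniteEntropy ν

/-- The kurtosis (fourth moment) of one component of the base distribution. -/
def kurtosis (ν : Measure ℝ) : ℝ := ∫ x : ℝ, x ^ 4 ∂ν

/-- A nonlinear diagonal conditioner `φ : ℝ → ℝ₊`: twice differentiable, `1`-Lipschitz and
`Lφ`-log-smooth. -/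
structure IsConditioner (Lφ : ℝ) (φ : ℝ → ℝ) : Prop where
  pos : ∀ x, 0 < φ x
  differentiable : Differentiable ℝ φ
  differentiable_deriv : Differentiable ℝ (deriv φ)
  lipschitz : LipschitzWith 1 φ
  log_smooth : IsSmooth Lφ fun x => Real.log (φ x)

/-- `lik` is a positive likelihood and `prior` a positive probability density. -/
structure IsModel (lik prior : Vec d → ℝ) : Prop where
  measurable_lik : Measurable lik
  measurable_prior : Measurable prior
  lik_pos : ∀ z, 0 < lik z
  prior_pos : ∀ z, 0 < prior z
  prior_integral : ∫ z, prior z = 1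

/-- With `g = ∇ℓ ∘ T_λ` (`ℓ` the negative joint log-likelihood):
`|𝔼 g_i(λ; u) u_i φ''(s_i)| ≤ Ls` for all parameters `λ` and all coordinates `i`. -/
def RotationBound (fam : ScaleFamily) (φ : ℝ → ℝ) (ν : Measure ℝ) (lik prior : Vec d → ℝ)
    (Ls : ℝ) : Prop :=
  0 < Ls ∧ ∀ (l : Param fam d) (i : Fin d),
    |∫ u, gradient (negLogJoint lik prior) (reparam φ l u) i * u i * deriv (deriv φ) (diagParam l i)
      ∂(baseLaw ν d)| ≤ Ls

/-- The constant `C(d, φ)`: `d + k_φ` for Cholesky, `2 k_φ √d + 1` for mean-field. -/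
def varConst (fam : ScaleFamily) (d : ℕ) (ν : Measure ℝ) : ℝ :=
  match fam with
  | .meanField => 2 * kurtosis ν * √(d : ℝ) + 1
  | .cholesky => d + kurtosis ν

/-- The `M`-sample reparameterization gradient estimator of the energy. -/
def reparamGrad (φ : ℝ → ℝ) (lik prior : Vec d → ℝ) {M : ℕ} (u : Fin M → Vec d)
    (l : Param fam d) : Param fam d :=
  (1 / (M : ℝ)) • ∑ m, gradient (fun l' => negLogJoint lik prior (reparam φ l' (u m))) l

/-- The iterates of SGD with stepsize `γ`, started at `l₀`, driven by the samples `U t m`. -/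
def sgd {Ω : Type*} (φ : ℝ → ℝ) (ν : Measure ℝ) (lik prior : Vec d → ℝ) {M : ℕ} (γ : ℝ)
    (U : ℕ → Fin M → Ω → Vec d) (l₀ : Param fam d) : ℕ → Ω → Param fam d
  | 0, _ => l₀
  | t + 1, ω =>
    let l := sgd φ ν lik prior γ U l₀ t ω
    l - γ • (reparamGrad φ lik prior (fun m => U t m ω) l + gradient (entropicReg φ ν) l)

/-- The samples are independent, over iterations and within a batch, with law `q`. -/
structure IsIIDSamples {Ω : Type*} [MeasurableSpace Ω] (P : Measure Ω) {M : ℕ}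
    (U : ℕ → Fin M → Ω → Vec d) (q : Measure (Vec d)) : Prop where
  measurable : ∀ t m, Measurable (U t m)
  law : ∀ t m, P.map (U t m) = q
  indep : iIndepFun (fun p : ℕ × Fin M => U p.1 p.2) P

/-- For some fixed stepsize, the iterates of every run of SGD with `M` samples per step satisfy
`min_{0 ≤ t ≤ T-1} 𝔼 ‖∇F(λ_t)‖ ≤ ε` as soon as `T ≥ N` (and `T ≥ 1`). -/
def FindsStationary (φ : ℝ → ℝ) (ν : Measure ℝ) (lik prior : Vec d → ℝ) (M : ℕ)
    (l₀ : Param fam d) (ε N : ℝ) : Prop :=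
  ∃ γ : ℝ, 0 < γ ∧
    ∀ (Ω : Type u) [MeasurableSpace Ω] (P : Measure Ω) [IsProbabilityMeasure P]
      (U : ℕ → Fin M → Ω → Vec d), IsIIDSamples P U (baseLaw ν d) →
      ∀ T : ℕ, 1 ≤ T → N ≤ T → ∃ t < T,
        Integrable (fun ω => ‖gradient (negELBO φ ν lik prior) (sgd φ ν lik prior γ U l₀ t ω)‖) P ∧
        ∫ ω, ‖gradient (negELBO φ ν lik prior) (sgd φ ν lik prior γ U l₀ t ω)‖ ∂P ≤ ε

end

end BBVI

namespace BBVI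

open MeasureTheory ProbabilityTheory

noncomputable section

open scoped InnerProductSpace Topology ENNReal

/-! ### Smooth functions and Lipschitz bounds -/

section Smooth

variable {E : Type*} [NormedAddCommGroup E] [InnerProductSpace ℝ E] [CompleteSpace E]

/-! In the coordinates `v = conditioned φ l` the sample `C u + m` is linear in `v`. The functions
`1, u_1, …, u_d` are orthonormal in `L²` of the base law, and two parameters acting on the same row
multiply different ones of them. Hence `𝔼‖linReparam v u‖² = ‖v‖²` (`integral_norm_sq_linReparam`),
an isometry that transfers estimates between `ℝᵈ` and parameter space without loss.

Smoothness of `F`: by the isometry, `v ↦ 𝔼 ℓ(linReparam v u)` inherits the smoothness constant of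
`ℓ`. Undoing the conditioner multiplies its gradient by `φ'(s)` on the diagonal coordinates. Since
`|φ'| ≤ 1` and `conditioned φ` is 1-Lipschitz, the variation of the gradient costs `L`, while the
variation of `φ'` is what the rotation bound `Ls` controls (`isSmooth_energy`). The entropy is a
constant plus `∑ log φ(s_i)` (`entropicReg_eq`), which costs `Lφ`.

Noise: `∇ℓ` vanishes at the minimizer `z̄`, so the second moment of the reparameterization gradient
is at most `C(d,φ) L² ‖v - constParam z̄‖²` (`integral_norm_sq_adjReparam_le`). This distance is in
turn controlled by the objective: `F(λ) = 𝔼 ℓ_like + KL(q_λ ‖ p) ≥ 𝔼 ℓ_like`, and quadratic growth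
with the isometry gives `‖v - constParam z̄‖² ≤ (4/μ)(F(λ) - ℓ*_like) + 2Δ²`
(`norm_conditioned_sub_sq_le`). The gradient noise is thus affine in `F - F*`.

SGD: the descent lemma yields `D_{t+1} + (γ/2) r_t ≤ (1 + a) D_t + b`, with `D_t = 𝔼 F(λ_t) - F*`,
`r_t = 𝔼‖∇F(λ_t)‖²` and `a`, `b` of order `γ²`. With `γ` of order `δ/(T ε²)` and `T` large the
factor `(1 + a)^T` stays below `e`, and `r_t > ε²` for all `t < T` would make `D_T` negative
(`exists_le_of_recursion`). -/

theorem IsSmooth.continuous_gradient {L : ℝ} {f : E → ℝ} (hf : IsSmooth L f) :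
    Continuous (gradient f) := by
  have h : LipschitzWith (Real.toNNReal L) (gradient f) := by
    refine LipschitzWith.of_dist_le_mul fun x y => ?_
    rw [dist_eq_norm, dist_eq_norm]
    exact (hf.2 x y).trans
      (mul_le_mul_of_nonneg_right (Real.le_coe_toNNReal L) (norm_nonneg _))
  exact h.continuous

/-- The quadratic two-sided bound of the first-order Taylor remainder of an `L`-smooth function. -/
theorem IsSmooth.abs_taylor_le {L : ℝ} {f : E → ℝ} (hf : IsSmooth L f) (x v : E) :
    |f (x + v) - f x - ⟪gradient f x, v⟫_ℝ| ≤ L / 2 * ‖v‖ ^ 2 := by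
  -- Along the segment the remainder has derivative at most `L * ‖v‖ ^ 2 * t` in absolute value,
  -- which is the derivative of the comparison function in `hB`. This needs no integral form of the
  -- remainder.
  have hd : ∀ t : ℝ, HasDerivAt (fun t : ℝ => f (x + t • v) - f x - t * ⟪gradient f x, v⟫_ℝ)
      (⟪gradient f (x + t • v) - gradient f x, v⟫_ℝ) t := by
    intro t
    have h1 : HasDerivAt (fun t : ℝ => x + t • v) v t := by
      simpa using ((hasDerivAt_id t).smul_const v).const_add x
    have h2 := ((hf.1 (x + t • v)).hasGradientAt.hasFDerivAt.comp_hasDerivAt t h1)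
    have h3 := (h2.sub_const (f x)).sub ((hasDerivAt_id t).mul_const ⟪gradient f x, v⟫_ℝ)
    refine h3.congr_deriv ?_
    rw [inner_sub_left]
    simp
  have hB : ∀ t : ℝ, HasDerivAt (fun t : ℝ => L / 2 * ‖v‖ ^ 2 * t ^ 2) (L * ‖v‖ ^ 2 * t) t := by
    intro t
    have := (hasDerivAt_pow 2 t).const_mul (L / 2 * ‖v‖ ^ 2)
    refine this.congr_deriv ?_
    norm_num
    ring
  have key := image_norm_le_of_norm_deriv_right_le_deriv_boundary (a := (0 : ℝ)) (b := 1)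
    (f := fun t : ℝ => f (x + t • v) - f x - t * ⟪gradient f x, v⟫_ℝ)
    (fun t _ => (hd t).continuousAt.continuousWithinAt)
    (fun t _ => (hd t).hasDerivWithinAt) (B := fun t => L / 2 * ‖v‖ ^ 2 * t ^ 2)
    (by simp) hB (fun t ht => by
      refine (norm_inner_le_norm _ _).trans ?_
      have h := hf.2 (x + t • v) x
      rw [add_sub_cancel_left, norm_smul, Real.norm_of_nonneg ht.1] at h
      nlinarith [norm_nonneg v])
  have := key (Set.right_mem_Icc.2 zero_le_one)
  simpa using this

end Smooth

/-- A map whose upper metric derivative is at most `K` at every point is `K`-Lipschitz. -/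
theorem norm_sub_le_of_eventually_norm_sub_le {E F : Type*} [NormedAddCommGroup E]
    [NormedSpace ℝ E] [NormedAddCommGroup F] [NormedSpace ℝ F] {g : E → F} {K : ℝ}
    (h : ∀ x, ∀ η > 0, ∀ᶠ y in 𝓝 x, ‖g y - g x‖ ≤ (K + η) * ‖y - x‖) (x y : E) :
    ‖g x - g y‖ ≤ K * ‖x - y‖ := by
  have hcont : Continuous g := by
    rw [continuous_iff_continuousAt]
    intro z
    rw [ContinuousAt, tendsto_iff_norm_sub_tendsto_zero]
    refine squeeze_zero' (Filter.Eventually.of_forall fun _ => norm_nonneg _) (h z 1 one_pos) ?_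
    have : Filter.Tendsto (fun y => (K + 1) * ‖y - z‖) (𝓝 z) (𝓝 ((K + 1) * ‖z - z‖)) :=
      Continuous.tendsto (by fun_prop) z
    simpa using this
  rcases eq_or_ne x y with rfl | hxy
  · simp
  have hpos : 0 < ‖x - y‖ := norm_pos_iff.2 (sub_ne_zero.2 hxy)
  -- The loss `e` pays for a slope `K + 2 * η` along the segment: one `η` comes from the hypothesis,
  -- the other makes the comparison of slopes strict.
  refine le_of_forall_pos_le_add fun e he => ?_
  set η := e / (2 * ‖x - y‖) with hη
  have hηpos : 0 < η := by positivity
  set c : ℝ → E := fun t => y + t • (x - y) with hc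
  have hcc : Continuous c := by fun_prop
  have key := image_norm_le_of_liminf_right_slope_norm_lt_deriv_boundary (a := (0 : ℝ)) (b := 1)
    (f := fun t => g (c t) - g y) (f' := fun _ => (K + η) * ‖x - y‖)
    (B := fun t => (K + 2 * η) * ‖x - y‖ * t) (B' := fun _ => (K + 2 * η) * ‖x - y‖)
    ((hcont.comp hcc).sub continuous_const).continuousOn
    (fun t _ r hr => by
      have h1 : ∀ᶠ z in 𝓝 t, ‖g (c z) - g (c t)‖ ≤ (K + η) * ‖c z - c t‖ :=
        hcc.continuousAt.eventually (h (c t) η hηpos)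
      refine Filter.Eventually.frequently ?_
      filter_upwards [nhdsWithin_le_nhds h1, self_mem_nhdsWithin] with z hz hzt
      have hzt : 0 < z - t := sub_pos.2 hzt
      refine lt_of_le_of_lt ?_ hr
      rw [slope_def_field, div_le_iff₀ hzt]
      have h2 : c z - c t = (z - t) • (x - y) := by
        simp only [hc]; module
      rw [h2, norm_smul, Real.norm_of_nonneg hzt.le] at hz
      have h3 := norm_sub_norm_le (g (c z) - g y) (g (c t) - g y)
      rw [sub_sub_sub_cancel_right] at h3
      calc _ ≤ _ := h3
        _ ≤ _ := hz
        _ = _ := by ring)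
    (by simp [hc]) (by fun_prop) (fun t _ => by
      simpa using ((hasDerivAt_id t).const_mul ((K + 2 * η) * ‖x - y‖)).hasDerivWithinAt)
    (fun t _ _ => by nlinarith)
  have h1 := key (Set.right_mem_Icc.2 zero_le_one)
  simp only [hc, one_smul, add_sub_cancel, mul_one] at h1
  have h2 : (K + 2 * η) * ‖x - y‖ = K * ‖x - y‖ + e := by
    rw [hη]; field_simp
  exact h1.trans h2.le

variable {fam : ScaleFamily} {d : ℕ} {ν : Measure ℝ}

/-! ### Moments of the base law -/

theorem IsBaseComponent.integrable_pow (hν : IsBaseComponent ν) {n : ℕ} (hn : n ≤ 4) :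
    Integrable (fun x : ℝ => x ^ n) ν := by
  have := hν.prob
  refine Integrable.mono' ((integrable_const (1 : ℝ)).add hν.integrable_pow_four)
    (by fun_prop) (Filter.Eventually.of_forall fun x => ?_)
  rw [Real.norm_eq_abs, abs_pow]
  have h4 : x ^ 4 = |x| ^ 4 := by rw [← abs_pow, abs_of_nonneg (by positivity)]
  simp only [Pi.add_apply, h4]
  rcases le_total |x| 1 with h | h
  · have := pow_le_one₀ (n := n) (abs_nonneg x) h
    linarith [pow_nonneg (abs_nonneg x) 4]
  · have := pow_le_pow_right₀ h hn
    linarith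

/-- Expand `𝔼 (x² - 1)² ≥ 0`. It lets bounds for the factor `u_j`, whose fourth moment is the
kurtosis, also cover the constant factor `1`. -/
theorem IsBaseComponent.one_le_kurtosis (hν : IsBaseComponent ν) : 1 ≤ kurtosis ν := by
  have := hν.prob
  have h : 0 ≤ ∫ x : ℝ, (x ^ 4 - 2 * x ^ 2 + 1) ∂ν :=
    integral_nonneg fun x => by
      have : x ^ 4 - 2 * x ^ 2 + 1 = (x ^ 2 - 1) ^ 2 := by ring
      exact this ▸ sq_nonneg (x ^ 2 - 1)
  have hsub : Integrable (fun x : ℝ => x ^ 4 - 2 * x ^ 2) ν := (hν.integrable_pow le_rfl).sub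
    ((hν.integrable_pow (by norm_num : 2 ≤ 4)).const_mul 2)
  rw [integral_add hsub (integrable_const _), integral_sub (hν.integrable_pow le_rfl)
      ((hν.integrable_pow (by norm_num : 2 ≤ 4)).const_mul 2), integral_const_mul, hν.second] at h
  simp only [integral_const, probReal_univ, smul_eq_mul] at h
  rw [kurtosis]
  linarith

theorem IsBaseComponent.isProbabilityMeasure_baseLaw (hν : IsBaseComponent ν) :
    IsProbabilityMeasure (baseLaw ν d) := by
  have := hν.prob
  exact Measure.isProbabilityMeasure_map (by fun_prop)

theorem integral_baseLaw (f : Vec d → ℝ) :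
    ∫ u, f u ∂(baseLaw ν d) = ∫ x, f (WithLp.toLp 2 x) ∂(Measure.pi fun _ : Fin d => ν) :=
  (MeasurableEquiv.toLp 2 (Fin d → ℝ)).measurableEmbedding.integral_map f

theorem integrable_baseLaw {f : Vec d → ℝ} :
    Integrable f (baseLaw ν d) ↔
      Integrable (fun x => f (WithLp.toLp 2 x)) (Measure.pi fun _ : Fin d => ν) :=
  (MeasurableEquiv.toLp 2 (Fin d → ℝ)).measurableEmbedding.integrable_map_iff

theorem IsBaseComponent.integrable_monomial (hν : IsBaseComponent ν) {a : Fin d → ℕ}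
    (ha : ∀ i, a i ≤ 4) : Integrable (fun u : Vec d => ∏ i, u i ^ a i) (baseLaw ν d) := by
  have := hν.prob
  rw [integrable_baseLaw]
  exact Integrable.fintype_prod_dep fun i => hν.integrable_pow (ha i)

theorem IsBaseComponent.integral_monomial (hν : IsBaseComponent ν) (a : Fin d → ℕ) :
    ∫ u : Vec d, ∏ i, u i ^ a i ∂(baseLaw ν d) = ∏ i, ∫ x : ℝ, x ^ a i ∂ν := by
  have := hν.prob
  rw [integral_baseLaw]
  exact integral_fintype_prod_eq_prod (fun i (x : ℝ) => x ^ a i)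

theorem IsBaseComponent.integral_monomial_eq_zero (hν : IsBaseComponent ν) (a : Fin d → ℕ)
    (i : Fin d) (hi : a i = 1 ∨ a i = 3) :
    ∫ u : Vec d, ∏ i, u i ^ a i ∂(baseLaw ν d) = 0 := by
  rw [hν.integral_monomial]
  refine Finset.prod_eq_zero (Finset.mem_univ i) ?_
  rcases hi with hi | hi
  · simpa [hi] using hν.mean
  · simpa [hi] using hν.third

theorem prod_pow_single (u : Vec d) (i : Fin d) (n : ℕ) :
    ∏ k, u k ^ (Pi.single i n : Fin d → ℕ) k = u i ^ n := by
  rw [Finset.prod_eq_single i]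
  · simp
  · intro k _ hk
    simp [Pi.single_eq_of_ne hk]
  · simp

theorem prod_pow_add (u : Vec d) (a b : Fin d → ℕ) :
    ∏ k, u k ^ (a + b) k = (∏ k, u k ^ a k) * ∏ k, u k ^ b k := by
  simp [pow_add, Finset.prod_mul_distrib]

theorem IsBaseComponent.integrable_apply_pow (hν : IsBaseComponent ν) (i : Fin d) {n : ℕ}
    (hn : n ≤ 4) : Integrable (fun u : Vec d => u i ^ n) (baseLaw ν d) := by
  have := hν.integrable_monomial (a := Pi.single i n) (d := d) fun k => by
    rcases eq_or_ne k i with rfl | h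
    · simpa using hn
    · simp [Pi.single_eq_of_ne h]
  simpa only [prod_pow_single] using this

theorem IsBaseComponent.integral_apply_pow (hν : IsBaseComponent ν) (i : Fin d) (n : ℕ) :
    ∫ u : Vec d, u i ^ n ∂(baseLaw ν d) = ∫ x : ℝ, x ^ n ∂ν := by
  have := hν.prob
  have := hν.integral_monomial (Pi.single i n : Fin d → ℕ)
  simp only [prod_pow_single] at this
  rw [this, Finset.prod_eq_single i]
  · simp
  · intro k _ hk
    simp [Pi.single_eq_of_ne hk]
  · simp

theorem IsBaseComponent.integrable_norm_pow_four (hν : IsBaseComponent ν) :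
    Integrable (fun u : Vec d => ‖u‖ ^ 4) (baseLaw ν d) := by
  refine Integrable.mono' (g := fun u => d * ∑ i, u i ^ 4)
    ((integrable_finsetSum _ fun i _ => hν.integrable_apply_pow i le_rfl).const_mul _)
    (by fun_prop) (Filter.Eventually.of_forall fun u => ?_)
  have h := sq_sum_le_card_mul_sum_sq (s := Finset.univ) (f := fun i => u i ^ 2)
  rw [Real.norm_of_nonneg (by positivity), show ‖u‖ ^ 4 = (‖u‖ ^ 2) ^ 2 by ring,
    EuclideanSpace.real_norm_sq_eq]
  simpa [← pow_mul] using h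

/-- Functions of at most quartic growth are integrable against the base law. -/
theorem IsBaseComponent.integrable_of_le (hν : IsBaseComponent ν) {f : Vec d → ℝ}
    (hf : AEStronglyMeasurable f (baseLaw ν d)) (K : ℝ) (h : ∀ u, |f u| ≤ K * (1 + ‖u‖) ^ 4) :
    Integrable f (baseLaw ν d) := by
  have := hν.isProbabilityMeasure_baseLaw (d := d)
  refine Integrable.mono' (g := fun u => |K| * (8 * (1 + ‖u‖ ^ 4)))
    ((((integrable_const _).add hν.integrable_norm_pow_four).const_mul _).const_mul _) hf
    (Filter.Eventually.of_forall fun u => (h u).trans ?_)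
  refine mul_le_mul (le_abs_self K) ?_ (by positivity) (abs_nonneg K)
  have := add_pow_le (zero_le_one) (norm_nonneg u) 4
  norm_num at this
  linarith

/-! ### The reparameterization in linear coordinates -/

/-- The coordinates of the parameter space. -/
abbrev Idx (fam : ScaleFamily) (d : ℕ) : Type :=
  Fin d ⊕ Fin d ⊕ {p : Fin d × Fin d // p ∈ fam.offDiag d}

/-- The row of the sample that a coordinate acts on. -/
def rowIdx : Idx fam d → Fin d
  | .inl i => i
  | .inr (.inl i) => i
  | .inr (.inr p) => p.1.1

/-- The component of the noise that a coordinate multiplies, if any. -/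
def colIdx : Idx fam d → Option (Fin d)
  | .inl _ => none
  | .inr (.inl i) => some i
  | .inr (.inr p) => some p.1.2

theorem ScaleFamily.lt_of_mem_offDiag {p : Fin d × Fin d} (hp : p ∈ fam.offDiag d) :
    p.2 < p.1 := by
  cases fam
  · simp [ScaleFamily.offDiag] at hp
  · simpa [ScaleFamily.offDiag] using hp

/-- Strict lower triangularity keeps the entries of `L` apart from the diagonal. This is what
removes all cross terms in the second moments of the sample. -/
theorem idx_ext {p q : Idx fam d} (hr : rowIdx p = rowIdx q) (hc : colIdx p = colIdx q) :
    p = q := by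
  rcases p with i | i | ⟨⟨i, j⟩, hp⟩ <;> rcases q with i' | i' | ⟨⟨i', j'⟩, hq⟩ <;>
    simp only [rowIdx, colIdx, reduceCtorEq, Option.some.injEq] at hr hc <;> subst hr
  · rfl
  · rfl
  · exact absurd hc (ne_of_gt (ScaleFamily.lt_of_mem_offDiag hq))
  · exact absurd hc (ne_of_lt (ScaleFamily.lt_of_mem_offDiag hp))
  · subst hc; rfl

/-- The factor of a coordinate: `1` for locations and a component of the noise for scales. -/
def factor (c : Option (Fin d)) (u : Vec d) : ℝ :=
  match c with
  | none => 1
  | some j => u j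

@[fun_prop]
theorem continuous_factor (c : Option (Fin d)) : Continuous (factor c) := by
  cases c
  · exact continuous_const
  · exact (PiLp.continuous_apply 2 _ _)

theorem abs_factor_le (c : Option (Fin d)) (u : Vec d) : |factor c u| ≤ 1 + ‖u‖ := by
  cases c with
  | none => simp [factor]
  | some j =>
    have := PiLp.norm_apply_le u j
    rw [Real.norm_eq_abs] at this
    simp only [factor]
    linarith

/-- The location-scale map with scale matrix linear in the parameters. -/
def linReparam (v : Param fam d) (u : Vec d) : Vec d :=
  ∑ p : Idx fam d, (v p * factor (colIdx p) u) • EuclideanSpace.single (rowIdx p) (1 : ℝ)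

/-- The adjoint of `linReparam` in the parameter. -/
def adjReparam (g u : Vec d) : Param fam d :=
  WithLp.toLp 2 fun p : Idx fam d => g (rowIdx p) * factor (colIdx p) u

theorem continuous_linReparam :
    Continuous fun x : Param fam d × Vec d => linReparam x.1 x.2 := by
  unfold linReparam
  refine continuous_finsetSum _ fun p _ => ?_
  have := (continuous_factor (colIdx p)).comp (continuous_snd (X := Param fam d))
  have h : Continuous fun x : Param fam d × Vec d => x.1 p := by fun_prop
  exact (h.mul this).smul continuous_const

theorem linReparam_add (v w : Param fam d) (u : Vec d) :
    linReparam (v + w) u = linReparam v u + linReparam w u := by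
  simp [linReparam, add_mul, add_smul, Finset.sum_add_distrib]

theorem linReparam_sub (v w : Param fam d) (u : Vec d) :
    linReparam (v - w) u = linReparam v u - linReparam w u := by
  simp [linReparam, sub_mul, sub_smul, Finset.sum_sub_distrib]

theorem inner_linReparam (g u : Vec d) (v : Param fam d) :
    ⟪g, linReparam v u⟫_ℝ = ⟪adjReparam g u, v⟫_ℝ := by
  simp only [linReparam, inner_sum, inner_smul_right,
    PiLp.inner_apply, adjReparam]
  refine Finset.sum_congr rfl fun p _ => ?_
  simp
  ring

theorem norm_linReparam_le (v : Param fam d) (u : Vec d) :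
    ‖linReparam v u‖ ≤ Fintype.card (Idx fam d) * ‖v‖ * (1 + ‖u‖) := by
  unfold linReparam
  refine (norm_sum_le _ _).trans ?_
  refine (Finset.sum_le_card_nsmul _ _ (‖v‖ * (1 + ‖u‖)) fun p _ => ?_).trans_eq ?_
  · rw [norm_smul, norm_mul]
    simp only [PiLp.norm_single, norm_one, mul_one]
    exact mul_le_mul (PiLp.norm_apply_le v p) (abs_factor_le _ _) (abs_nonneg _) (norm_nonneg _)
  · rw [nsmul_eq_mul, Finset.card_univ]
    ring

theorem norm_sq_linReparam (v : Param fam d) (u : Vec d) :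
    ‖linReparam v u‖ ^ 2 = ∑ p : Idx fam d, ∑ q : Idx fam d, if rowIdx p = rowIdx q then
      v p * v q * (factor (colIdx p) u * factor (colIdx q) u) else 0 := by
  rw [← real_inner_self_eq_norm_sq]
  unfold linReparam
  simp only [sum_inner]
  simp only [inner_sum, inner_smul_left, inner_smul_right]
  refine Finset.sum_congr rfl fun p _ => Finset.sum_congr rfl fun q _ => ?_
  simp only [EuclideanSpace.inner_single_left]
  by_cases h : rowIdx p = rowIdx q
  · simp [h]; ring
  · simp [h]

/-- Expectation of a weighted squared norm of the sample, when the weight keeps the factors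
orthogonal. -/
theorem integral_mul_norm_sq_linReparam {P : Measure (Vec d)} {ρ : Vec d → ℝ}
    (hi : ∀ a b, Integrable (fun u => ρ u * (factor a u * factor b u)) P)
    (ho : ∀ a b, a ≠ b → ∫ u, ρ u * (factor a u * factor b u) ∂P = 0) (v : Param fam d) :
    ∫ u, ρ u * ‖linReparam v u‖ ^ 2 ∂P =
      ∑ p : Idx fam d, v p ^ 2 * ∫ u, ρ u * factor (colIdx p) u ^ 2 ∂P := by
  simp only [norm_sq_linReparam, Finset.mul_sum, mul_ite, mul_zero]
  have hterm : ∀ (p q : Idx fam d), (fun u => if rowIdx p = rowIdx q then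
      ρ u * (v p * v q * (factor (colIdx p) u * factor (colIdx q) u)) else 0) =
      fun u => (if rowIdx p = rowIdx q then v p * v q else 0) *
        (ρ u * (factor (colIdx p) u * factor (colIdx q) u)) := by
    intro p q
    funext u
    split_ifs
    · ring
    · simp
  have hint : ∀ (p q : Idx fam d), Integrable (fun u => if rowIdx p = rowIdx q then
      ρ u * (v p * v q * (factor (colIdx p) u * factor (colIdx q) u)) else 0) P := by
    intro p q
    rw [hterm]
    exact (hi _ _).const_mul _
  rw [integral_finsetSum _ fun p _ => integrable_finsetSum _ fun q _ => hint p q]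
  refine Finset.sum_congr rfl fun p _ => ?_
  rw [integral_finsetSum _ fun q _ => hint p q, Finset.sum_eq_single p]
  · simp only [if_true, sq]
    rw [← integral_const_mul]
    exact integral_congr_ae (Filter.Eventually.of_forall fun u => by ring)
  · intro q _ hq
    rw [hterm, integral_const_mul]
    -- Different rows are orthogonal in `ℝᵈ`; within one row, different parameters have different
    -- factors, which are orthogonal under the weight.
    by_cases hr : rowIdx p = rowIdx q
    · rw [ho _ _ fun hc => hq (idx_ext hr hc).symm, mul_zero]
    · simp [hr]
  · simp

/-- The exponent vector of a factor. -/
def factorExp (c : Option (Fin d)) : Fin d → ℕ :=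
  match c with
  | none => 0
  | some j => Pi.single j 1

theorem prod_pow_factorExp (c : Option (Fin d)) (u : Vec d) :
    ∏ k, u k ^ factorExp c k = factor c u := by
  cases c
  · simp [factorExp, factor]
  · simp only [factorExp, factor, prod_pow_single, pow_one]

theorem factorExp_le (c : Option (Fin d)) (k : Fin d) : factorExp c k ≤ 1 := by
  cases c with
  | none => simp [factorExp]
  | some j =>
    rcases eq_or_ne k j with rfl | h
    · simp [factorExp]
    · simp [factorExp, Pi.single_eq_of_ne h]

/-- A component with exponent one has mean zero, so by independence the whole moment vanishes: this
is the orthogonality of distinct factors. -/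
theorem factorExp_add_eq_one {a b : Option (Fin d)} (hab : a ≠ b) :
    ∃ i, (factorExp a + factorExp b) i = 1 := by
  rcases a with _ | j <;> rcases b with _ | k
  · exact absurd rfl hab
  · exact ⟨k, by simp [factorExp]⟩
  · exact ⟨j, by simp [factorExp]⟩
  · have : j ≠ k := fun h => hab (by rw [h])
    exact ⟨j, by simp [factorExp, Pi.single_eq_of_ne this]⟩

theorem IsBaseComponent.integrable_factor_mul (hν : IsBaseComponent ν) (a b : Option (Fin d)) :
    Integrable (fun u => factor a u * factor b u) (baseLaw ν d) := by
  have := hν.integrable_monomial (a := factorExp a + factorExp b) fun k => by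
    have h1 := factorExp_le a k
    have h2 := factorExp_le b k
    simp only [Pi.add_apply]; omega
  simpa only [prod_pow_add, prod_pow_factorExp] using this

theorem IsBaseComponent.integral_factor_mul (hν : IsBaseComponent ν) {a b : Option (Fin d)}
    (hab : a ≠ b) : ∫ u, factor a u * factor b u ∂(baseLaw ν d) = 0 := by
  obtain ⟨i, hi⟩ := factorExp_add_eq_one hab
  have := hν.integral_monomial_eq_zero _ i (Or.inl hi)
  simpa only [prod_pow_add, prod_pow_factorExp] using this

theorem IsBaseComponent.integral_factor_sq (hν : IsBaseComponent ν) (a : Option (Fin d)) :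
    ∫ u, factor a u ^ 2 ∂(baseLaw ν d) = 1 := by
  have := hν.isProbabilityMeasure_baseLaw (d := d)
  cases a with
  | none => simp [factor]
  | some j => simp only [factor]; rw [hν.integral_apply_pow, hν.second]

theorem IsBaseComponent.integrable_sq_mul_factor_mul (hν : IsBaseComponent ν) (l : Fin d)
    (a b : Option (Fin d)) :
    Integrable (fun u => u l ^ 2 * (factor a u * factor b u)) (baseLaw ν d) := by
  have := hν.integrable_monomial (a := Pi.single l 2 + (factorExp a + factorExp b)) fun k => by
    have h1 := factorExp_le a k
    have h2 := factorExp_le b k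
    have h3 : (Pi.single l 2 : Fin d → ℕ) k ≤ 2 := by
      rcases eq_or_ne k l with rfl | h
      · simp
      · simp [Pi.single_eq_of_ne h]
    simp only [Pi.add_apply]; omega
  simpa only [prod_pow_add, prod_pow_single, prod_pow_factorExp] using this

/-- The weight `u_l²` raises an exponent `1` to `3` when it hits the same component, so here the
vanishing third moment is needed besides the vanishing mean. -/
theorem IsBaseComponent.integral_sq_mul_factor_mul (hν : IsBaseComponent ν) (l : Fin d)
    {a b : Option (Fin d)} (hab : a ≠ b) :
    ∫ u, u l ^ 2 * (factor a u * factor b u) ∂(baseLaw ν d) = 0 := by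
  obtain ⟨i, hi⟩ := factorExp_add_eq_one hab
  have := hν.integral_monomial_eq_zero (Pi.single l 2 + (factorExp a + factorExp b)) i (by
    rcases eq_or_ne i l with rfl | h
    · right; simp only [Pi.add_apply, Pi.single_eq_same] at hi ⊢; omega
    · left; simp only [Pi.add_apply, Pi.single_eq_of_ne h] at hi ⊢; omega)
  simpa only [prod_pow_add, prod_pow_single, prod_pow_factorExp] using this

theorem IsBaseComponent.integral_sq_mul_sq (hν : IsBaseComponent ν) {l j : Fin d} (h : l ≠ j) :
    ∫ u : Vec d, u l ^ 2 * u j ^ 2 ∂(baseLaw ν d) = 1 := by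
  have := hν.prob
  have := hν.integral_monomial (Pi.single l 2 + Pi.single j 2 : Fin d → ℕ)
  simp only [prod_pow_add, prod_pow_single] at this
  rw [this]
  refine Finset.prod_eq_one fun k _ => ?_
  rcases eq_or_ne k l with rfl | hk
  · simpa [Pi.single_eq_of_ne h] using hν.second
  · rcases eq_or_ne k j with rfl | hk'
    · simpa [Pi.single_eq_of_ne hk] using hν.second
    · simp [Pi.single_eq_of_ne hk, Pi.single_eq_of_ne hk']

/-- The reparameterization is an isometry into the square-integrable random vectors. -/
theorem IsBaseComponent.integral_norm_sq_linReparam (hν : IsBaseComponent ν) (v : Param fam d) :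
    ∫ u, ‖linReparam v u‖ ^ 2 ∂(baseLaw ν d) = ‖v‖ ^ 2 := by
  have := integral_mul_norm_sq_linReparam (P := baseLaw ν d) (ρ := fun _ => 1)
    (by simpa using hν.integrable_factor_mul) (by simpa using fun a b => hν.integral_factor_mul) v
  simp only [one_mul, hν.integral_factor_sq, mul_one] at this
  rw [this, EuclideanSpace.real_norm_sq_eq]

theorem measurable_linReparam (v : Param fam d) : Measurable (linReparam v) :=
  (continuous_linReparam.comp (Continuous.prodMk_right v)).measurable

theorem IsBaseComponent.integrable_norm_sq_linReparam (hν : IsBaseComponent ν)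
    (v : Param fam d) : Integrable (fun u => ‖linReparam v u‖ ^ 2) (baseLaw ν d) := by
  refine hν.integrable_of_le ((measurable_linReparam v).norm.pow_const 2).aestronglyMeasurable
    ((Fintype.card (Idx fam d) * ‖v‖) ^ 2) fun u => ?_
  rw [abs_of_nonneg (by positivity)]
  calc ‖linReparam v u‖ ^ 2 ≤ (Fintype.card (Idx fam d) * ‖v‖ * (1 + ‖u‖)) ^ 2 :=
        pow_le_pow_left₀ (norm_nonneg _) (norm_linReparam_le v u) 2
    _ = (Fintype.card (Idx fam d) * ‖v‖) ^ 2 * (1 + ‖u‖) ^ 2 := by ring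
    _ ≤ _ := by
        refine mul_le_mul_of_nonneg_left ?_ (by positivity)
        exact pow_le_pow_right₀ (by linarith [norm_nonneg u]) (by norm_num)

theorem norm_le_of_abs_apply_le {ι : Type*} [Fintype ι] {x y : EuclideanSpace ℝ ι} {c : ℝ}
    (hc : 0 ≤ c) (h : ∀ p, |x p| ≤ c * |y p|) : ‖x‖ ≤ c * ‖y‖ := by
  refine (sq_le_sq₀ (norm_nonneg _) (by positivity)).1 ?_
  rw [mul_pow, EuclideanSpace.real_norm_sq_eq, EuclideanSpace.real_norm_sq_eq, Finset.mul_sum]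
  refine Finset.sum_le_sum fun p _ => ?_
  have := pow_le_pow_left₀ (abs_nonneg _) (h p) 2
  rwa [mul_pow, sq_abs, sq_abs] at this

/-- A quadratic remainder bound can be integrated in `u`, so this replaces differentiation under the
integral sign. -/
theorem hasGradientAt_of_abs_le {E : Type*} [NormedAddCommGroup E] [InnerProductSpace ℝ E]
    [CompleteSpace E] {f : E → ℝ} {g x : E} {K : ℝ}
    (h : ∀ v, |f (x + v) - f x - ⟪g, v⟫_ℝ| ≤ K * ‖v‖ ^ 2) : HasGradientAt f g x := by
  rw [hasGradientAt_iff_isLittleO_nhds_zero]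
  have h1 : (fun v : E => f (x + v) - f x - ⟪g, v⟫_ℝ) =O[𝓝 0] fun v => ‖v‖ ^ 2 :=
    Asymptotics.IsBigO.of_bound K (Filter.Eventually.of_forall fun v => by
      simpa using h v)
  refine h1.trans_isLittleO ?_
  simpa using Asymptotics.isLittleO_norm_pow_id (E' := E) one_lt_two

/-! ### The nonlinear conditioner -/

/-- The linear coordinates of a variational parameter: `φ` is applied to the diagonal scales. -/
def conditioned (φ : ℝ → ℝ) (l : Param fam d) : Param fam d :=
  WithLp.toLp 2 fun
    | .inl i => l (.inl i)
    | .inr (.inl i) => φ (l (.inr (.inl i)))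
    | .inr (.inr q) => l (.inr (.inr q))

/-- The diagonal of the derivative of `conditioned`. -/
def conditionedDeriv (φ : ℝ → ℝ) (l : Param fam d) : Idx fam d → ℝ
  | .inl _ => 1
  | .inr (.inl i) => deriv φ (l (.inr (.inl i)))
  | .inr (.inr _) => 1

theorem linReparam_apply (v : Param fam d) (u : Vec d) (i : Fin d) :
    linReparam v u i =
      ∑ p : Idx fam d, if rowIdx p = i then v p * factor (colIdx p) u else 0 := by
  simp only [linReparam, WithLp.ofLp_sum, Finset.sum_apply]
  refine Finset.sum_congr rfl fun p _ => ?_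
  by_cases h : rowIdx p = i
  · simp [h]
  · simp [h, Ne.symm h]

theorem reparam_eq_linReparam (φ : ℝ → ℝ) (l : Param fam d) (u : Vec d) :
    reparam φ l u = linReparam (conditioned φ l) u := by
  ext i
  rw [linReparam_apply, Fintype.sum_sum_type, Fintype.sum_sum_type]
  change _ = (∑ k : Fin d, if k = i then l (.inl k) * 1 else 0) +
    ((∑ k : Fin d, if k = i then φ (l (.inr (.inl k))) * u k else 0) +
      ∑ q : {p : Fin d × Fin d // p ∈ fam.offDiag d},
        if q.1.1 = i then l (.inr (.inr q)) * u q.1.2 else 0)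
  simp only [Finset.sum_ite_eq', Finset.mem_univ, if_true, mul_one]
  have hoff : (∑ q : {p : Fin d × Fin d // p ∈ fam.offDiag d},
      if q.1.1 = i then l (.inr (.inr q)) * u q.1.2 else 0) =
      ∑ j, (if h : (i, j) ∈ fam.offDiag d then l (.inr (.inr ⟨(i, j), h⟩)) else 0) * u j := by
    -- Extending the off-diagonal entries by zero to all positions turns the sum over free
    -- parameters into the full sum of row `i`.
    set H : Fin d × Fin d → ℝ := fun q => if q.1 = i then
      (if h : q ∈ fam.offDiag d then l (.inr (.inr ⟨q, h⟩)) else 0) * u q.2 else 0 with hH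
    have h1 := Finset.sum_coe_sort (fam.offDiag d) H
    have h2 : ∑ q ∈ fam.offDiag d, H q = ∑ q, H q :=
      Finset.sum_subset (Finset.subset_univ _) fun q _ hq => by simp [hH, hq]
    rw [h2, Fintype.sum_prod_type,
      Finset.sum_eq_single i (fun k _ hk => by simp [hH, hk]) (by simp)] at h1
    simp only [hH, if_true] at h1
    rw [← h1]
    refine Finset.sum_congr rfl fun q _ => ?_
    have : (q : Fin d × Fin d) ∈ fam.offDiag d := q.2
    simp [this]
  rw [hoff]
  simp only [reparam, location, scaleMatrix, diagParam, PiLp.add_apply, Matrix.mulVec, dotProduct,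
    Matrix.of_apply]
  rw [add_comm]
  congr 1
  have hdiag : φ (l (.inr (.inl i))) * u i =
      ∑ j, if i = j then φ (l (.inr (.inl j))) * u j else 0 := by simp
  rw [hdiag, ← Finset.sum_add_distrib]
  refine Finset.sum_congr rfl fun j _ => ?_
  by_cases hij : i = j
  · subst hij
    have : (i, i) ∉ fam.offDiag d := fun h => absurd (ScaleFamily.lt_of_mem_offDiag h) (lt_irrefl _)
    simp [this]
  · simp [hij]

theorem continuous_reparam {φ : ℝ → ℝ} (hφ : Continuous φ) :
    Continuous fun x : Param fam d × Vec d => reparam φ x.1 x.2 := by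
  have hc : Continuous fun l : Param fam d => conditioned φ l := by
    refine (PiLp.continuous_toLp 2 _).comp (continuous_pi fun p => ?_)
    rcases p with i | i | q
    · exact PiLp.continuous_apply 2 _ _
    · exact hφ.comp (PiLp.continuous_apply 2 _ _)
    · exact PiLp.continuous_apply 2 _ _
  simp only [reparam_eq_linReparam]
  exact continuous_linReparam.comp ((hc.comp continuous_fst).prodMk continuous_snd)

theorem IsConditioner.abs_deriv_le {Lφ : ℝ} {φ : ℝ → ℝ} (hφ : IsConditioner Lφ φ) (x : ℝ) :
    |deriv φ x| ≤ 1 := by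
  simpa using norm_deriv_le_of_lipschitz (x₀ := x) hφ.lipschitz

theorem IsConditioner.abs_conditionedDeriv_le {Lφ : ℝ} {φ : ℝ → ℝ} (hφ : IsConditioner Lφ φ)
    (l : Param fam d) (p : Idx fam d) : |conditionedDeriv φ l p| ≤ 1 := by
  rcases p with i | i | q
  · simp [conditionedDeriv]
  · exact hφ.abs_deriv_le _
  · simp [conditionedDeriv]

theorem IsConditioner.norm_conditioned_sub_le {Lφ : ℝ} {φ : ℝ → ℝ} (hφ : IsConditioner Lφ φ)
    (l l' : Param fam d) : ‖conditioned φ l - conditioned φ l'‖ ≤ ‖l - l'‖ := by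
  have h : ∀ p, |(conditioned φ l - conditioned φ l') p| ≤ 1 * |(l - l') p| := by
    intro p
    rcases p with i | i | q
    · simp [conditioned]
    · have := hφ.lipschitz.dist_le_mul (l (.inr (.inl i))) (l' (.inr (.inl i)))
      simpa [conditioned, Real.dist_eq] using this
    · simp [conditioned]
  simpa using norm_le_of_abs_apply_le zero_le_one h

/-- The conditioner acts coordinate by coordinate, so its derivative is diagonal and equal to its
adjoint. The statement takes any differentiable `φ` because it is also applied to `log ∘ φ`. -/
theorem hasGradientAt_comp_conditioned {φ : ℝ → ℝ} (hφ : Differentiable ℝ φ)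
    {f : Param fam d → ℝ} {l g : Param fam d} (hf : HasGradientAt f g (conditioned φ l)) :
    HasGradientAt (fun l => f (conditioned φ l))
      (WithLp.toLp 2 fun p => conditionedDeriv φ l p * g p) l := by
  have hc : HasFDerivAt (fun l : Param fam d => conditioned φ l)
      (((PiLp.continuousLinearEquiv 2 ℝ fun _ : Idx fam d => ℝ).symm : _ →L[ℝ] _).comp
        (ContinuousLinearMap.pi fun p =>
          conditionedDeriv φ l p • (PiLp.proj 2 (fun _ : Idx fam d => ℝ) p : Param fam d →L[ℝ] ℝ)))
      l := by
    rw [← hasFDerivWithinAt_univ, hasFDerivWithinAt_euclidean]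
    intro p
    rw [hasFDerivWithinAt_univ]
    have hp : ∀ p : Idx fam d, HasFDerivAt (fun l : Param fam d => l p)
        (PiLp.proj 2 (fun _ : Idx fam d => ℝ) p : Param fam d →L[ℝ] ℝ) l := fun p =>
      (PiLp.proj 2 (fun _ : Idx fam d => ℝ) p : Param fam d →L[ℝ] ℝ).hasFDerivAt
    rcases p with i | i | q
    · refine (hp (.inl i)).congr_fderiv ?_
      ext h
      exact (one_mul _).symm
    · exact (hφ _).hasDerivAt.comp_hasFDerivAt l (hp (.inr (.inl i)))
    · refine (hp (.inr (.inr q))).congr_fderiv ?_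
      ext h
      exact (one_mul _).symm
  rw [hasGradientAt_iff_hasFDerivAt] at hf ⊢
  refine (hf.comp l hc).congr_fderiv ?_
  ext h
  simp only [ContinuousLinearMap.comp_apply, InnerProductSpace.toDual_apply_apply,
    PiLp.inner_apply]
  refine Finset.sum_congr rfl fun p _ => ?_
  simp
  ring

/-! ### The energy in linear coordinates -/

section Energy

variable {L : ℝ} {ℓ : Vec d → ℝ}

theorem IsSmooth.norm_gradient_le (hℓ : IsSmooth L ℓ) (z : Vec d) :
    ‖gradient ℓ z‖ ≤ ‖gradient ℓ 0‖ + L * ‖z‖ := by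
  have h := hℓ.2 z 0
  rw [sub_zero] at h
  have := norm_le_norm_add_norm_sub (gradient ℓ 0) (gradient ℓ z)
  rw [norm_sub_rev] at h
  linarith

theorem IsSmooth.exists_norm_gradient_linReparam_le (hL : 0 ≤ L) (hℓ : IsSmooth L ℓ)
    (v : Param fam d) : ∃ A, 0 ≤ A ∧ ∀ u, ‖gradient ℓ (linReparam v u)‖ ≤ A * (1 + ‖u‖) := by
  refine ⟨‖gradient ℓ 0‖ + L * (Fintype.card (Idx fam d) * ‖v‖), by positivity, fun u => ?_⟩
  refine (hℓ.norm_gradient_le _).trans ?_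
  have := mul_le_mul_of_nonneg_left (norm_linReparam_le v u) hL
  have h2 : ‖gradient ℓ 0‖ * 1 ≤ ‖gradient ℓ 0‖ * (1 + ‖u‖) :=
    mul_le_mul_of_nonneg_left (by linarith [norm_nonneg u]) (norm_nonneg _)
  linarith

theorem continuous_linReparam_right (v : Param fam d) : Continuous (linReparam v) :=
  continuous_linReparam.comp (Continuous.prodMk_right v)

theorem IsSmooth.continuous_gradient_linReparam_right (hℓ : IsSmooth L ℓ) (v : Param fam d) :
    Continuous fun u => gradient ℓ (linReparam v u) :=
  hℓ.continuous_gradient.comp (continuous_linReparam_right v)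

theorem IsSmooth.continuous_adjReparam_gradient_apply (hℓ : IsSmooth L ℓ) (v : Param fam d)
    (p : Idx fam d) :
    Continuous fun u => (adjReparam (gradient ℓ (linReparam v u)) u : Param fam d) p := by
  have h : Continuous fun u => gradient ℓ (linReparam v u) (rowIdx p) :=
    (PiLp.continuous_apply 2 (fun _ : Fin d => ℝ) (rowIdx p)).comp
      (hℓ.continuous_gradient_linReparam_right v)
  exact h.mul (continuous_factor _)

theorem abs_adjReparam_apply_le (g u : Vec d) (p : Idx fam d) :
    |(adjReparam g u : Param fam d) p| ≤ ‖g‖ * (1 + ‖u‖) := by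
  simp only [adjReparam, abs_mul]
  exact mul_le_mul (PiLp.norm_apply_le g _) (abs_factor_le _ _) (abs_nonneg _) (norm_nonneg _)

theorem one_add_norm_pow_le (u : Vec d) {n : ℕ} (hn : n ≤ 4) : (1 + ‖u‖) ^ n ≤ (1 + ‖u‖) ^ 4 :=
  pow_le_pow_right₀ (by linarith [norm_nonneg u]) hn

theorem IsBaseComponent.integrable_adjReparam (hν : IsBaseComponent ν) (hL : 0 ≤ L)
    (hℓ : IsSmooth L ℓ) (v : Param fam d) (p : Idx fam d) :
    Integrable (fun u => (adjReparam (gradient ℓ (linReparam v u)) u : Param fam d) p)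
      (baseLaw ν d) := by
  obtain ⟨A, hA, h⟩ := hℓ.exists_norm_gradient_linReparam_le hL v
  refine hν.integrable_of_le (Continuous.aestronglyMeasurable ?_) A fun u => ?_
  · exact hℓ.continuous_adjReparam_gradient_apply v p
  · calc _ ≤ ‖gradient ℓ (linReparam v u)‖ * (1 + ‖u‖) := abs_adjReparam_apply_le _ _ _
      _ ≤ A * (1 + ‖u‖) * (1 + ‖u‖) := by gcongr; exact h u
      _ = A * (1 + ‖u‖) ^ 2 := by ring
      _ ≤ _ := mul_le_mul_of_nonneg_left (one_add_norm_pow_le u (by norm_num)) hA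

theorem IsBaseComponent.integrable_adjReparam_sq (hν : IsBaseComponent ν) (hL : 0 ≤ L)
    (hℓ : IsSmooth L ℓ) (v : Param fam d) (p : Idx fam d) :
    Integrable (fun u => (adjReparam (gradient ℓ (linReparam v u)) u : Param fam d) p ^ 2)
      (baseLaw ν d) := by
  obtain ⟨A, hA, h⟩ := hℓ.exists_norm_gradient_linReparam_le hL v
  refine hν.integrable_of_le (Continuous.aestronglyMeasurable ?_) (A ^ 2) fun u => ?_
  · exact (hℓ.continuous_adjReparam_gradient_apply v p).pow 2
  · rw [abs_pow]
    calc _ ≤ (‖gradient ℓ (linReparam v u)‖ * (1 + ‖u‖)) ^ 2 :=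
          pow_le_pow_left₀ (abs_nonneg _) (abs_adjReparam_apply_le _ _ _) 2
      _ ≤ (A * (1 + ‖u‖) * (1 + ‖u‖)) ^ 2 := by gcongr; exact h u
      _ = _ := by ring

theorem IsBaseComponent.integrable_comp_linReparam (hν : IsBaseComponent ν)
    (hℓ : IsSmooth L ℓ) (v : Param fam d) :
    Integrable (fun u => ℓ (linReparam v u)) (baseLaw ν d) := by
  have hprob := hν.isProbabilityMeasure_baseLaw (d := d)
  have hB : ∀ z, |ℓ z| ≤ (|ℓ 0| + ‖gradient ℓ 0‖ ^ 2) + (1 + L / 2) * ‖z‖ ^ 2 := by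
    intro z
    have h1 := abs_le.1 (hℓ.abs_taylor_le 0 z)
    rw [zero_add] at h1
    have h2 := abs_le.1 (abs_real_inner_le_norm (gradient ℓ 0) z)
    have h3 := abs_le.1 (le_refl |ℓ 0|)
    have h4 : ‖gradient ℓ 0‖ * ‖z‖ ≤ ‖gradient ℓ 0‖ ^ 2 + ‖z‖ ^ 2 := by
      nlinarith [sq_nonneg (‖gradient ℓ 0‖ - ‖z‖), sq_nonneg ‖gradient ℓ 0‖, sq_nonneg ‖z‖]
    rw [abs_le]
    constructor <;> linarith
  refine Integrable.mono' ((integrable_const _).add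
    ((hν.integrable_norm_sq_linReparam v).const_mul (1 + L / 2)))
    (hℓ.1.continuous.comp (continuous_linReparam_right v)).aestronglyMeasurable
    (Filter.Eventually.of_forall fun u => hB _)

/-- The gradient of the energy in linear coordinates. -/
def meanGradient (ν : Measure ℝ) (ℓ : Vec d → ℝ) (v : Param fam d) : Param fam d :=
  WithLp.toLp 2 fun p => ∫ u, (adjReparam (gradient ℓ (linReparam v u)) u : Param fam d) p
    ∂(baseLaw ν d)

theorem IsBaseComponent.integrable_inner (hν : IsBaseComponent ν) (hL : 0 ≤ L)
    (hℓ : IsSmooth L ℓ) (v h : Param fam d) :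
    Integrable (fun u => ⟪gradient ℓ (linReparam v u), linReparam h u⟫_ℝ) (baseLaw ν d) := by
  simp only [inner_linReparam]
  simp only [PiLp.inner_apply]
  refine integrable_finsetSum _ fun p _ => ?_
  simpa using (hν.integrable_adjReparam hL hℓ v p).const_mul (h p)

theorem IsBaseComponent.inner_meanGradient (hν : IsBaseComponent ν) (hL : 0 ≤ L)
    (hℓ : IsSmooth L ℓ) (v h : Param fam d) :
    ⟪meanGradient ν ℓ v, h⟫_ℝ =
      ∫ u, ⟪gradient ℓ (linReparam v u), linReparam h u⟫_ℝ ∂(baseLaw ν d) := by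
  simp only [inner_linReparam]
  simp only [PiLp.inner_apply, RCLike.inner_apply, conj_trivial]
  rw [integral_finsetSum _ fun p _ => (hν.integrable_adjReparam hL hℓ v p).const_mul (h p)]
  refine Finset.sum_congr rfl fun p _ => ?_
  rw [integral_const_mul, meanGradient]

/-- Integrating the Taylor bound of `ℓ` at `linReparam v u` leaves a remainder `L / 2 * 𝔼‖linReparam
h u‖²`, which is `L / 2 * ‖h‖²` by the isometry. -/
theorem IsBaseComponent.hasGradientAt_integral (hν : IsBaseComponent ν) (hL : 0 ≤ L)
    (hℓ : IsSmooth L ℓ) (v : Param fam d) :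
    HasGradientAt (fun v : Param fam d => ∫ u, ℓ (linReparam v u) ∂(baseLaw ν d))
      (meanGradient ν ℓ v) v := by
  refine hasGradientAt_of_abs_le (K := L / 2) fun h => ?_
  have i1 := hν.integrable_comp_linReparam hℓ (v + h)
  have i2 := hν.integrable_comp_linReparam hℓ v
  have i3 : Integrable (fun u => ℓ (linReparam (v + h) u) - ℓ (linReparam v u)) (baseLaw ν d) :=
    i1.sub i2
  rw [hν.inner_meanGradient hL hℓ, ← integral_sub i1 i2,
    ← integral_sub i3 (hν.integrable_inner hL hℓ v h),
    ← hν.integral_norm_sq_linReparam h, ← integral_const_mul]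
  refine abs_integral_le_integral_abs.trans (integral_mono
    (i3.sub (hν.integrable_inner hL hℓ v h)).abs
    ((hν.integrable_norm_sq_linReparam h).const_mul _) fun u => ?_)
  simp only [linReparam_add]
  exact hℓ.abs_taylor_le _ _

/-- Duality: test the difference against `h`, apply Cauchy–Schwarz pointwise and `2ab ≤ a² + b²`,
then integrate with the isometry. Balancing the two squares afterwards recovers the sharp constant
`L`. -/
theorem IsBaseComponent.norm_meanGradient_sub_le (hν : IsBaseComponent ν) (hL : 0 ≤ L)
    (hℓ : IsSmooth L ℓ) (v w : Param fam d) :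
    ‖meanGradient ν ℓ v - meanGradient ν ℓ w‖ ≤ L * ‖v - w‖ := by
  have key : ∀ h : Param fam d, ⟪meanGradient ν ℓ v - meanGradient ν ℓ w, h⟫_ℝ ≤
      L / 2 * (‖v - w‖ ^ 2 + ‖h‖ ^ 2) := by
    intro h
    rw [inner_sub_left, hν.inner_meanGradient hL hℓ, hν.inner_meanGradient hL hℓ,
      ← integral_sub (hν.integrable_inner hL hℓ v h) (hν.integrable_inner hL hℓ w h),
      ← hν.integral_norm_sq_linReparam h, ← hν.integral_norm_sq_linReparam (v - w),
      ← integral_add (hν.integrable_norm_sq_linReparam _) (hν.integrable_norm_sq_linReparam _),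
      ← integral_const_mul]
    refine integral_mono
      ((hν.integrable_inner hL hℓ v h).sub (hν.integrable_inner hL hℓ w h))
      (((hν.integrable_norm_sq_linReparam _).add
        (hν.integrable_norm_sq_linReparam _)).const_mul _) fun u => ?_
    simp only [← inner_sub_left, linReparam_sub]
    have h1 := real_inner_le_norm (gradient ℓ (linReparam v u) - gradient ℓ (linReparam w u))
      (linReparam h u)
    have h2 := hℓ.2 (linReparam v u) (linReparam w u)
    have h3 := mul_le_mul_of_nonneg_right h2 (norm_nonneg (linReparam h u))
    have h4 : L * ‖linReparam v u - linReparam w u‖ * ‖linReparam h u‖ ≤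
        L / 2 * (‖linReparam v u - linReparam w u‖ ^ 2 + ‖linReparam h u‖ ^ 2) := by
      have := mul_nonneg hL (sq_nonneg (‖linReparam v u - linReparam w u‖ - ‖linReparam h u‖))
      linarith
    linarith
  set D := ‖v - w‖ with hD
  set n := ‖meanGradient ν ℓ v - meanGradient ν ℓ w‖ with hn
  have hD0 : 0 ≤ D := norm_nonneg _
  rcases (norm_nonneg (meanGradient ν ℓ v - meanGradient ν ℓ w)).eq_or_lt with h0 | h0
  · rw [hn, ← h0]; positivity
  rw [← hn] at h0
  -- The test vector points along the difference and is scaled to length `D`, so that both squares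
  -- on the right of `key` equal `D²`.
  have h1 := key ((D / n) • (meanGradient ν ℓ v - meanGradient ν ℓ w))
  rw [inner_smul_right, real_inner_self_eq_norm_sq, norm_smul, ← hn, Real.norm_of_nonneg
    (by positivity), div_mul_cancel₀ _ h0.ne'] at h1
  have h2 : D / n * n ^ 2 = D * n := by field_simp
  rw [h2] at h1
  rcases hD0.eq_or_lt with hD1 | hD1
  · have : v = w := sub_eq_zero.1 (norm_eq_zero.1 (hD ▸ hD1.symm))
    rw [hn, this]; simp; positivity
  · refine le_of_mul_le_mul_left ?_ hD1
    linarith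

end Energy

/-! ### Smoothness of the energy -/

theorem measurable_reparam {φ : ℝ → ℝ} (hφ : Continuous φ) (l : Param fam d) :
    Measurable (reparam φ l) :=
  ((continuous_reparam hφ).comp (Continuous.prodMk_right l)).measurable

theorem energy_eq {L Lφ : ℝ} {φ : ℝ → ℝ} {lik prior : Vec d → ℝ} (hφ : IsConditioner Lφ φ)
    (hℓ : IsSmooth L (negLogJoint lik prior)) (l : Param fam d) :
    energy φ ν lik prior l =
      ∫ u, negLogJoint lik prior (linReparam (conditioned φ l) u) ∂(baseLaw ν d) := by
  rw [energy, variational, integral_map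
    (measurable_reparam hφ.differentiable.continuous l).aemeasurable
    hℓ.1.continuous.aestronglyMeasurable]
  simp only [reparam_eq_linReparam]

theorem IsBaseComponent.hasGradientAt_energy (hν : IsBaseComponent ν) {L Lφ : ℝ} {φ : ℝ → ℝ}
    {lik prior : Vec d → ℝ} (hφ : IsConditioner Lφ φ) (hL : 0 ≤ L)
    (hℓ : IsSmooth L (negLogJoint lik prior)) (l : Param fam d) :
    HasGradientAt (energy φ ν lik prior) (WithLp.toLp 2 fun p => conditionedDeriv φ l p *
      meanGradient ν (negLogJoint lik prior) (conditioned φ l) p) l := by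
  have h := hasGradientAt_comp_conditioned hφ.differentiable
    (hν.hasGradientAt_integral hL hℓ (conditioned φ l))
  simpa only [← energy_eq hφ hℓ] using h

/-- The function `φ''` need not be continuous, and the rotation bound only speaks of `φ''(s_i)`
times the mean gradient at the same parameter. The estimate is therefore made infinitesimally at
each point and globalized by `norm_sub_le_of_eventually_norm_sub_le`. -/
theorem IsBaseComponent.isSmooth_energy (hν : IsBaseComponent ν) {L Lφ Ls : ℝ} {φ : ℝ → ℝ}
    {lik prior : Vec d → ℝ} (hφ : IsConditioner Lφ φ) (hL : 0 ≤ L)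
    (hℓ : IsSmooth L (negLogJoint lik prior)) (hrot : RotationBound fam φ ν lik prior Ls) :
    IsSmooth (L + Ls) (energy (fam := fam) φ ν lik prior) := by
  have hg := fun l : Param fam d => hν.hasGradientAt_energy hφ hL hℓ l
  refine ⟨fun l => (hg l).differentiableAt, ?_⟩
  refine norm_sub_le_of_eventually_norm_sub_le fun l η hη => ?_
  set G := meanGradient (fam := fam) ν (negLogJoint lik prior) with hG
  have hrot' : ∀ i, |deriv (deriv φ) (l (.inr (.inl i))) * G (conditioned φ l) (.inr (.inl i))|
      ≤ Ls := by
    intro i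
    have := hrot.2 l i
    rw [integral_mul_const, mul_comm] at this
    simp only [reparam_eq_linReparam] at this
    exact this
  have hev : ∀ i : Fin d, ∀ᶠ l' in 𝓝 l,
      |(deriv φ (l' (.inr (.inl i))) - deriv φ (l (.inr (.inl i)))) *
        G (conditioned φ l) (.inr (.inl i))| ≤ (Ls + η) * |l' (.inr (.inl i)) - l (.inr (.inl i))|
      := by
    intro i
    set s := l (.inr (.inl i)) with hs
    set c := G (conditioned φ l) (.inr (.inl i)) with hc
    -- The error in the first-order expansion of `φ'` gets multiplied by `c`; this tolerance keeps
    -- the product below `η`, and the `1 +` allows `c = 0`.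
    have hη' : 0 < η / (1 + |c|) := by positivity
    have h1 := (hφ.differentiable_deriv s).hasDerivAt.isLittleO.def hη'
    have h2 : Filter.Tendsto (fun l' : Param fam d => l' (.inr (.inl i))) (𝓝 l) (𝓝 s) :=
      (PiLp.continuous_apply 2 _ _).tendsto l
    filter_upwards [h2.eventually h1] with l' hl'
    set s' := l' (.inr (.inl i)) with hs'
    simp only [Real.norm_eq_abs, smul_eq_mul] at hl'
    have h3 : (deriv φ s' - deriv φ s) * c = (s' - s) * (deriv (deriv φ) s * c) +
        (deriv φ s' - deriv φ s - (s' - s) * deriv (deriv φ) s) * c := by ring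
    have h4 : η / (1 + |c|) * |c| ≤ η := by
      rw [div_mul_eq_mul_div, div_le_iff₀ (by positivity)]
      nlinarith [abs_nonneg c]
    rw [h3]
    refine (abs_add_le _ _).trans ?_
    rw [abs_mul, abs_mul (deriv φ s' - deriv φ s - _)]
    calc _ ≤ |s' - s| * Ls + η / (1 + |c|) * |s' - s| * |c| := by
          gcongr
          exact hrot' i
      _ = |s' - s| * Ls + η / (1 + |c|) * |c| * |s' - s| := by ring
      _ ≤ |s' - s| * Ls + η * |s' - s| := by gcongr
      _ = _ := by ring
  filter_upwards [Filter.eventually_all.2 hev] with l' hl'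
  rw [(hg l).gradient, (hg l').gradient]
  -- In the second summand the mean gradient stays at the base point `l`, which is where the
  -- rotation bound is evaluated.
  have hsplit : (WithLp.toLp 2 fun p => conditionedDeriv φ l' p * G (conditioned φ l') p) -
      (WithLp.toLp 2 fun p => conditionedDeriv φ l p * G (conditioned φ l) p) =
      (WithLp.toLp 2 fun p => conditionedDeriv φ l' p *
        (G (conditioned φ l') - G (conditioned φ l)) p : Param fam d) +
      (WithLp.toLp 2 fun p => (conditionedDeriv φ l' p - conditionedDeriv φ l p) *
        G (conditioned φ l) p : Param fam d) := by
    ext p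
    simp only [PiLp.sub_apply, PiLp.add_apply]
    ring
  rw [hsplit]
  refine (norm_add_le _ _).trans ?_
  have e1 : ‖(WithLp.toLp 2 fun p => conditionedDeriv φ l' p *
        (G (conditioned φ l') - G (conditioned φ l)) p : Param fam d)‖ ≤ L * ‖l' - l‖ := by
    have := norm_le_of_abs_apply_le (c := 1) (x := (WithLp.toLp 2 fun p => conditionedDeriv φ l' p *
        (G (conditioned φ l') - G (conditioned φ l)) p : Param fam d))
        (y := G (conditioned φ l') - G (conditioned φ l)) zero_le_one fun p => by
      simp only [abs_mul]
      exact mul_le_mul_of_nonneg_right (hφ.abs_conditionedDeriv_le l' p) (abs_nonneg _)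
    rw [one_mul] at this
    exact this.trans ((hν.norm_meanGradient_sub_le hL hℓ _ _).trans
      (mul_le_mul_of_nonneg_left (hφ.norm_conditioned_sub_le l' l) hL))
  have e2 : ‖(WithLp.toLp 2 fun p => (conditionedDeriv φ l' p - conditionedDeriv φ l p) *
        G (conditioned φ l) p : Param fam d)‖ ≤ (Ls + η) * ‖l' - l‖ := by
    have hLs := hrot.1
    refine norm_le_of_abs_apply_le (by positivity) fun p => ?_
    rcases p with i | i | q
    · simp only [conditionedDeriv, sub_self, zero_mul, abs_zero]; positivity
    · simpa [conditionedDeriv] using hl' i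
    · simp only [conditionedDeriv, sub_self, zero_mul, abs_zero]; positivity
  linarith

/-! ### The density of the base law -/

/-- A product measure is determined by its values on boxes, where the integral of the product
density factorizes. -/
theorem pi_eq_withDensity_prod {ι : Type*} [Fintype ι] (ν : Measure ℝ) [IsProbabilityMeasure ν]
    (hν : ν ≪ volume) : Measure.pi (fun _ : ι => ν) =
      (volume : Measure (ι → ℝ)).withDensity
        fun x => ENNReal.ofReal (∏ i, (ν.rnDeriv volume (x i)).toReal) := by
  have hg : Integrable (fun x => (ν.rnDeriv volume x).toReal) :=
    Measure.integrable_toReal_rnDeriv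
  refine Measure.pi_eq fun s hs => ?_
  rw [withDensity_apply _ (MeasurableSet.univ_pi hs), volume_pi, Measure.restrict_pi_pi,
    ← ofReal_integral_eq_lintegral_ofReal
      (Integrable.fintype_prod_dep fun i => hg.integrableOn (s := s i))
      (Filter.Eventually.of_forall fun x => Finset.prod_nonneg fun i _ => ENNReal.toReal_nonneg),
    integral_fintype_prod_eq_prod (fun i (x : ℝ) => (ν.rnDeriv volume x).toReal),
    ENNReal.ofReal_prod_of_nonneg fun i _ => integral_nonneg fun _ => ENNReal.toReal_nonneg]
  refine Finset.prod_congr rfl fun i _ => ?_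
  rw [Measure.setIntegral_toReal_rnDeriv hν, ofReal_measureReal]

theorem rnDeriv_pi_toReal {ι : Type*} [Fintype ι] (ν : Measure ℝ) [IsProbabilityMeasure ν]
    (hν : ν ≪ volume) : ∀ᵐ x ∂(volume : Measure (ι → ℝ)),
      ((Measure.pi fun _ : ι => ν).rnDeriv volume x) =
        ENNReal.ofReal (∏ i, (ν.rnDeriv volume (x i)).toReal) := by
  rw [pi_eq_withDensity_prod ν hν]
  refine Measure.rnDeriv_withDensity _ (Measurable.ennreal_ofReal ?_)
  exact Finset.measurable_prod _ fun i _ =>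
    ((Measure.measurable_rnDeriv ν volume).comp (measurable_pi_apply i)).ennreal_toReal

theorem pi_absolutelyContinuous {ι : Type*} [Fintype ι] (ν : Measure ℝ) [IsProbabilityMeasure ν]
    (hν : ν ≪ volume) : Measure.pi (fun _ : ι => ν) ≪ volume := by
  rw [pi_eq_withDensity_prod ν hν]
  exact withDensity_absolutelyContinuous _ _

/-! ### The scale matrix and the change of variables -/

theorem det_scaleMatrix (φ : ℝ → ℝ) (l : Param fam d) :
    (scaleMatrix φ l).det = ∏ i, φ (diagParam l i) := by
  rw [Matrix.det_of_isLowerTriangular]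
  · simp [scaleMatrix]
  · intro i j hij
    have hij : i < j := hij
    have h : (i, j) ∉ fam.offDiag d := fun h =>
      absurd (ScaleFamily.lt_of_mem_offDiag h) (not_lt.2 hij.le)
    simp [scaleMatrix, h, hij.ne]

theorem det_scaleMatrix_pos {Lφ : ℝ} {φ : ℝ → ℝ} (hφ : IsConditioner Lφ φ) (l : Param fam d) :
    0 < (scaleMatrix φ l).det := by
  rw [det_scaleMatrix]
  exact Finset.prod_pos fun i _ => hφ.pos _

theorem measurableEmbedding_reparam {Lφ : ℝ} {φ : ℝ → ℝ} (hφ : IsConditioner Lφ φ)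
    (l : Param fam d) :
    MeasurableEmbedding fun x : Fin d → ℝ => reparam φ l (WithLp.toLp 2 x) := by
  refine Measurable.measurableEmbedding
    ((measurable_reparam hφ.differentiable.continuous l).comp (by fun_prop)) fun x y hxy => ?_
  simp only [reparam, add_left_inj] at hxy
  have hu : IsUnit (scaleMatrix φ l) := (Matrix.isUnit_iff_isUnit_det _).2
    (isUnit_iff_ne_zero.2 (det_scaleMatrix_pos hφ l).ne')
  exact Matrix.mulVec_injective_iff_isUnit.2 hu (WithLp.toLp_injective 2 hxy)

theorem map_reparam_volume {Lφ : ℝ} {φ : ℝ → ℝ} (hφ : IsConditioner Lφ φ) (l : Param fam d) :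
    (volume : Measure (Fin d → ℝ)).map (fun x => reparam φ l (WithLp.toLp 2 x)) =
      ENNReal.ofReal (scaleMatrix φ l).det⁻¹ • volume := by
  have hdet := det_scaleMatrix_pos hφ l
  have h1 := Real.map_matrix_volume_pi_eq_smul_volume_pi hdet.ne'
  rw [abs_of_pos (inv_pos.2 hdet)] at h1
  have hcomp : (fun x : Fin d → ℝ => reparam φ l (WithLp.toLp 2 x)) =
      (fun z => z + location l) ∘ (WithLp.toLp 2) ∘ (Matrix.toLin' (scaleMatrix φ l)) := by
    funext x
    simp [reparam]
  have hm : Measurable (Matrix.toLin' (scaleMatrix φ l)) :=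
    (LinearMap.continuous_of_finiteDimensional _).measurable
  have hlp : Measurable (WithLp.toLp 2 : (Fin d → ℝ) → Vec d) := by fun_prop
  rw [hcomp, ← Measure.map_map (by fun_prop) (hlp.comp hm), ← Measure.map_map hlp hm, h1,
    Measure.map_smul, (PiLp.volume_preserving_toLp (Fin d)).map_eq, Measure.map_smul,
    map_add_right_eq_self]

theorem variational_eq_map_pi {φ : ℝ → ℝ} (hφ : Continuous φ) (ν : Measure ℝ)
    (l : Param fam d) : variational φ ν l =
      (Measure.pi fun _ : Fin d => ν).map fun x => reparam φ l (WithLp.toLp 2 x) :=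
  Measure.map_map (measurable_reparam hφ l) (by fun_prop)

theorem IsBaseComponent.variational_absolutelyContinuous (hν : IsBaseComponent ν) {Lφ : ℝ}
    {φ : ℝ → ℝ} (hφ : IsConditioner Lφ φ) (l : Param fam d) : variational φ ν l ≪ volume := by
  have := hν.prob
  rw [variational_eq_map_pi hφ.differentiable.continuous]
  refine ((pi_absolutelyContinuous ν hν.entropy.1).map
    (measurableEmbedding_reparam hφ l).measurable).trans ?_
  rw [map_reparam_volume hφ]
  exact Measure.smul_absolutelyContinuous

/-- The log-density of the variational distribution along the reparameterization. -/
theorem IsBaseComponent.logDensity_reparam (hν : IsBaseComponent ν) {Lφ : ℝ} {φ : ℝ → ℝ}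
    (hφ : IsConditioner Lφ φ) (l : Param fam d) :
    ∀ᵐ x ∂(Measure.pi fun _ : Fin d => ν),
      logDensity (variational φ ν l) (reparam φ l (WithLp.toLp 2 x)) =
        ∑ i, logDensity ν (x i) - ∑ i, Real.log (φ (diagParam l i)) := by
  have := hν.prob
  have hac := hν.entropy.1
  have hemb := measurableEmbedding_reparam hφ l
  have hdet := det_scaleMatrix_pos hφ l
  set S := fun x : Fin d → ℝ => reparam φ l (WithLp.toLp 2 x) with hS
  set q := (Measure.pi fun _ : Fin d => ν).map S with hq
  have hqp : IsProbabilityMeasure q := Measure.isProbabilityMeasure_map hemb.measurable.aemeasurable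
  have hcne : ENNReal.ofReal (scaleMatrix φ l).det⁻¹ ≠ 0 := by simpa using hdet
  have h1 := hemb.rnDeriv_map (Measure.pi fun _ : Fin d => ν) volume
  rw [map_reparam_volume hφ] at h1
  -- The embedding formula gives the density relative to the image of Lebesgue measure, which is
  -- Lebesgue measure divided by the determinant; dividing out this constant yields the factor
  -- `det⁻¹`.
  have h2 : ∀ᵐ x ∂(volume : Measure (Fin d → ℝ)),
      q.rnDeriv (ENNReal.ofReal (scaleMatrix φ l).det⁻¹ • volume) (S x) =
        ((ENNReal.ofReal (scaleMatrix φ l).det⁻¹)⁻¹ • q.rnDeriv volume) (S x) := by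
    have h := Measure.rnDeriv_smul_right_of_ne_top' q volume hcne ENNReal.ofReal_ne_top
    have h' : ∀ᵐ z ∂((volume : Measure (Fin d → ℝ)).map S),
        q.rnDeriv (ENNReal.ofReal (scaleMatrix φ l).det⁻¹ • volume) z =
        ((ENNReal.ofReal (scaleMatrix φ l).det⁻¹)⁻¹ • q.rnDeriv volume) z := by
      rw [map_reparam_volume hφ]
      exact Measure.smul_absolutelyContinuous h
    exact hemb.ae_map_iff.1 h'
  -- Almost surely no factor of the density is zero, so the logarithm of the product splits into a
  -- sum.
  have hpos : ∀ᵐ x ∂(Measure.pi fun _ : Fin d => ν), ∀ i,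
      0 < (ν.rnDeriv volume (x i)).toReal := by
    refine Filter.eventually_all.2 fun i => ?_
    have h0 : ∀ᵐ y ∂ν, 0 < (ν.rnDeriv volume y).toReal := by
      filter_upwards [Measure.rnDeriv_pos hac, hac.ae_le (Measure.rnDeriv_ne_top ν volume)]
        with y h0 h1
      exact ENNReal.toReal_pos h0.ne' h1
    exact (measurePreserving_eval (fun _ : Fin d => ν) i).quasiMeasurePreserving.ae h0
  have hpi := pi_absolutelyContinuous (ι := Fin d) ν hac
  filter_upwards [hpi.ae_le h1, hpi.ae_le h2, hpi.ae_le (rnDeriv_pi_toReal (ι := Fin d) ν hac),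
    hpos] with x e1 e2 e3 hx
  rw [logDensity, variational_eq_map_pi hφ.differentiable.continuous]
  have e4 : q.rnDeriv volume (S x) = ENNReal.ofReal ((scaleMatrix φ l).det⁻¹ *
      ∏ i, (ν.rnDeriv volume (x i)).toReal) := by
    rw [ENNReal.ofReal_mul (inv_nonneg.2 hdet.le), ← e3, ← e1, e2, Pi.smul_apply, smul_eq_mul,
      ← mul_assoc, ENNReal.mul_inv_cancel hcne ENNReal.ofReal_ne_top, one_mul]
  have hprod : 0 < ∏ i, (ν.rnDeriv volume (x i)).toReal := Finset.prod_pos fun i _ => hx i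
  change Real.log (q.rnDeriv volume (S x)).toReal = _
  rw [e4, ENNReal.toReal_ofReal (by positivity), Real.log_mul (inv_pos.2 hdet).ne' hprod.ne',
    Real.log_inv, det_scaleMatrix, Real.log_prod fun i _ => (hφ.pos _).ne',
    Real.log_prod fun i _ => (hx i).ne']
  simp only [logDensity]
  ring

/-! ### Finite entropy and the entropic regularizer in closed form -/

theorem IsBaseComponent.integrable_logDensity_pi (hν : IsBaseComponent ν) (i : Fin d) :
    Integrable (fun x : Fin d → ℝ => logDensity ν (x i)) (Measure.pi fun _ : Fin d => ν) := by
  have := hν.prob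
  exact integrable_comp_eval (μ := fun _ : Fin d => ν) hν.entropy.2

theorem IsBaseComponent.hasFiniteEntropy_variational (hν : IsBaseComponent ν) {Lφ : ℝ}
    {φ : ℝ → ℝ} (hφ : IsConditioner Lφ φ) (l : Param fam d) :
    HasFiniteEntropy (variational φ ν l) := by
  have := hν.prob
  refine ⟨hν.variational_absolutelyContinuous hφ l, ?_⟩
  conv_rhs => rw [variational_eq_map_pi hφ.differentiable.continuous]
  rw [(measurableEmbedding_reparam hφ l).integrable_map_iff]
  refine ((integrable_finsetSum Finset.univ fun i _ => hν.integrable_logDensity_pi i).sub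
    (integrable_const (∑ i, Real.log (φ (diagParam l i))))).congr ?_
  filter_upwards [hν.logDensity_reparam hφ l] with x hx
  exact hx.symm

/-- An affine map shifts the entropy by the log-determinant, and a triangular determinant only sees
the diagonal. The regularizer is therefore independent of `m` and `L`. -/
theorem IsBaseComponent.entropicReg_eq (hν : IsBaseComponent ν) {Lφ : ℝ} {φ : ℝ → ℝ}
    (hφ : IsConditioner Lφ φ) (l : Param fam d) :
    entropicReg φ ν l = -(d * diffEntropy ν) - ∑ i, Real.log (φ (diagParam l i)) := by
  have := hν.prob
  have h : ∫ z, logDensity (variational φ ν l) z ∂(variational φ ν l) =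
      ∫ x : Fin d → ℝ, (∑ i, logDensity ν (x i) - ∑ i, Real.log (φ (diagParam l i)))
        ∂(Measure.pi fun _ : Fin d => ν) := by
    rw [← integral_congr_ae (hν.logDensity_reparam hφ l)]
    have h2 := (measurableEmbedding_reparam hφ l).integral_map (μ := Measure.pi fun _ : Fin d => ν)
      (logDensity (variational φ ν l))
    rwa [← variational_eq_map_pi hφ.differentiable.continuous] at h2
  rw [entropicReg, diffEntropy, neg_neg, h,
    integral_sub (integrable_finsetSum _ fun i _ => hν.integrable_logDensity_pi i)
      (integrable_const _), integral_finsetSum _ fun i _ => hν.integrable_logDensity_pi i]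
  have h3 : ∀ i : Fin d, ∫ x : Fin d → ℝ, logDensity ν (x i) ∂(Measure.pi fun _ : Fin d => ν) =
      ∫ y, logDensity ν y ∂ν := fun i =>
    integral_comp_eval (μ := fun _ : Fin d => ν) hν.entropy.2.aestronglyMeasurable
  simp [h3, diffEntropy]

/-- Minus the indicator of the diagonal scale coordinates. -/
def negDiagIndicator (fam : ScaleFamily) (d : ℕ) : Param fam d :=
  WithLp.toLp 2 fun
    | .inl _ => 0
    | .inr (.inl _) => -1
    | .inr (.inr _) => 0

/-- The regularizer is affine in the coordinates conditioned by `log ∘ φ`, so the chain rule for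
`conditioned` applies with `log ∘ φ` in place of `φ`. -/
theorem IsBaseComponent.hasGradientAt_entropicReg (hν : IsBaseComponent ν) {Lφ : ℝ} {φ : ℝ → ℝ}
    (hφ : IsConditioner Lφ φ) (l : Param fam d) :
    HasGradientAt (entropicReg φ ν) (WithLp.toLp 2 fun p =>
      conditionedDeriv (fun x => Real.log (φ x)) l p * negDiagIndicator fam d p) l := by
  have hlin : ∀ v : Param fam d, HasGradientAt
      (fun v : Param fam d => -(d * diffEntropy ν) + ⟪negDiagIndicator fam d, v⟫_ℝ)
      (negDiagIndicator fam d) v := by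
    intro v
    rw [hasGradientAt_iff_hasFDerivAt]
    exact ((InnerProductSpace.toDual ℝ _ (negDiagIndicator fam d)).hasFDerivAt).const_add _
  have h := hasGradientAt_comp_conditioned hφ.log_smooth.1 (hlin (conditioned _ l))
  have he : (fun l : Param fam d => -(d * diffEntropy ν) +
      ⟪negDiagIndicator fam d, conditioned (fun x => Real.log (φ x)) l⟫_ℝ) = entropicReg φ ν := by
    funext l
    rw [hν.entropicReg_eq hφ, PiLp.inner_apply, Fintype.sum_sum_type, Fintype.sum_sum_type]
    simp [negDiagIndicator, conditioned, diagParam]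
    ring
  rwa [he] at h

theorem IsConditioner.nonneg {Lφ : ℝ} {φ : ℝ → ℝ} (hφ : IsConditioner Lφ φ) : 0 ≤ Lφ := by
  have := (norm_nonneg _).trans (hφ.log_smooth.2 1 0)
  simpa using this

theorem IsBaseComponent.isSmooth_entropicReg (hν : IsBaseComponent ν) {Lφ : ℝ} {φ : ℝ → ℝ}
    (hφ : IsConditioner Lφ φ) : IsSmooth Lφ (entropicReg (fam := fam) (d := d) φ ν) := by
  have hg := fun l : Param fam d => hν.hasGradientAt_entropicReg hφ l
  refine ⟨fun l => (hg l).differentiableAt, fun l l' => ?_⟩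
  rw [(hg l).gradient, (hg l').gradient]
  have h0 := hφ.nonneg
  refine norm_le_of_abs_apply_le h0 fun p => ?_
  rcases p with i | i | q
  · simp [negDiagIndicator]; positivity
  · have := hφ.log_smooth.2 (l (.inr (.inl i))) (l' (.inr (.inl i)))
    rw [gradient_eq_deriv', gradient_eq_deriv'] at this
    simp only [PiLp.sub_apply, negDiagIndicator, conditionedDeriv, ← sub_mul, abs_mul, abs_neg,
      abs_one, mul_one]
    exact this
  · simp [negDiagIndicator]; positivity

/-! ### Second moment of the reparameterization gradient -/

/-- The linear coordinates of the constant reparameterization. -/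
def constParam (z : Vec d) : Param fam d :=
  WithLp.toLp 2 fun
    | .inl i => z i
    | .inr _ => 0

theorem linReparam_constParam (z u : Vec d) : linReparam (constParam z : Param fam d) u = z := by
  ext i
  rw [linReparam_apply, Fintype.sum_sum_type]
  change (∑ k : Fin d, if k = i then z k * 1 else 0) +
    (∑ k : Fin d ⊕ {p : Fin d × Fin d // p ∈ fam.offDiag d},
      if rowIdx (.inr k : Idx fam d) = i then 0 * factor (colIdx (.inr k : Idx fam d)) u else 0) = _
  simp

theorem gradient_eq_zero_of_mem_minimizers {E : Type*} [NormedAddCommGroup E]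
    [InnerProductSpace ℝ E] [CompleteSpace E] {f : E → ℝ} {z : E} (hz : z ∈ minimizers f) :
    gradient f z = 0 := by
  have : IsLocalMin f z := Filter.Eventually.of_forall hz
  rw [gradient, this.fderiv_eq_zero, map_zero]

theorem IsSmooth.norm_gradient_linReparam_le {L : ℝ} {ℓ : Vec d → ℝ} (hℓ : IsSmooth L ℓ)
    {z : Vec d} (hz : z ∈ minimizers ℓ) (v : Param fam d) (u : Vec d) :
    ‖gradient ℓ (linReparam v u)‖ ≤ L * ‖linReparam (v - constParam z) u‖ := by
  have := hℓ.2 (linReparam v u) z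
  rwa [gradient_eq_zero_of_mem_minimizers hz, sub_zero, ← linReparam_constParam (fam := fam) z u,
    ← linReparam_sub] at this

/-- The coordinates are products `g_i * factor`. Summing over all pairs of a row and a factor, not
only those that carry a parameter, gives exactly the right-hand side. -/
theorem norm_sq_adjReparam_le (g u : Vec d) :
    ‖(adjReparam g u : Param fam d)‖ ^ 2 ≤ (1 + ‖u‖ ^ 2) * ‖g‖ ^ 2 := by
  rw [EuclideanSpace.real_norm_sq_eq]
  set H : Fin d × Option (Fin d) → ℝ := fun x => (g x.1 * factor x.2 u) ^ 2 with hH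
  have hinj : Function.Injective fun p : Idx fam d => (rowIdx p, colIdx p) := fun p q h =>
    idx_ext (Prod.ext_iff.1 h).1 (Prod.ext_iff.1 h).2
  calc ∑ p : Idx fam d, (adjReparam g u : Param fam d) p ^ 2
      = ∑ x ∈ Finset.univ.image (fun p : Idx fam d => (rowIdx p, colIdx p)), H x := by
        rw [Finset.sum_image hinj.injOn]
        rfl
    _ ≤ ∑ x, H x := Finset.sum_le_sum_of_subset_of_nonneg (Finset.subset_univ _)
        fun x _ _ => sq_nonneg _
    _ = (1 + ‖u‖ ^ 2) * ‖g‖ ^ 2 := by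
        rw [Fintype.sum_prod_type, EuclideanSpace.real_norm_sq_eq, EuclideanSpace.real_norm_sq_eq,
          Finset.mul_sum]
        refine Finset.sum_congr rfl fun i _ => ?_
        simp only [hH, mul_pow, ← Finset.mul_sum, Fintype.sum_option, factor]
        ring

theorem sum_idx_meanField (H : Idx .meanField d → ℝ) :
    ∑ p, H p = ∑ i, (H (.inl i) + H (.inr (.inl i))) := by
  have : IsEmpty {p : Fin d × Fin d // p ∈ ScaleFamily.meanField.offDiag d} :=
    ⟨fun p => by simpa [ScaleFamily.offDiag] using p.2⟩
  have h : ∑ q : {p : Fin d × Fin d // p ∈ ScaleFamily.meanField.offDiag d}, H (.inr (.inr q)) = 0 :=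
    Fintype.sum_empty _
  rw [Fintype.sum_sum_type, Fintype.sum_sum_type, h, add_zero, ← Finset.sum_add_distrib]

/-- Row `i` contributes `g_i² (1 + u_i²)`. Bounding `max u_i²` by an `ℓ²`-norm of the squares,
instead of by `‖u‖²`, is what turns the factor `d` into `√d`. -/
theorem norm_sq_adjReparam_meanField_le (g u : Vec d) :
    ‖(adjReparam g u : Param .meanField d)‖ ^ 2 ≤ (1 + √(∑ i, u i ^ 4)) * ‖g‖ ^ 2 := by
  rw [EuclideanSpace.real_norm_sq_eq, sum_idx_meanField, EuclideanSpace.real_norm_sq_eq,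
    Finset.mul_sum]
  refine Finset.sum_le_sum fun i _ => ?_
  have h : u i ^ 2 ≤ √(∑ i, u i ^ 4) := by
    refine Real.le_sqrt_of_sq_le ?_
    rw [← pow_mul]
    exact Finset.single_le_sum (f := fun i => u i ^ 4) (fun j _ => by positivity)
      (Finset.mem_univ i)
  simp only [adjReparam, rowIdx, colIdx, factor]
  nlinarith [mul_le_mul_of_nonneg_right h (sq_nonneg (g i))]

/-- Each row has only two terms, so `(a + b)² ≤ 2a² + 2b²` decouples the parameters pointwise. This
is needed since the weight `√(∑ u_i⁴)` is no polynomial and orthogonality under it is not available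
from the moments. -/
theorem norm_sq_linReparam_meanField_le (v : Param .meanField d) (u : Vec d) :
    ‖linReparam v u‖ ^ 2 ≤
      2 * ∑ p : Idx .meanField d, v p ^ 2 * factor (colIdx p) u ^ 2 := by
  rw [EuclideanSpace.real_norm_sq_eq, sum_idx_meanField, Finset.mul_sum]
  refine Finset.sum_le_sum fun i _ => ?_
  have h : linReparam v u i = v (.inl i) + v (.inr (.inl i)) * u i := by
    rw [linReparam_apply, sum_idx_meanField, Finset.sum_add_distrib]
    change (∑ k : Fin d, if k = i then v (.inl k) * 1 else 0) +
      (∑ k : Fin d, if k = i then v (.inr (.inl k)) * u k else 0) = _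
    simp
  rw [h]
  simp only [colIdx, factor]
  nlinarith [sq_nonneg (v (.inl i) - v (.inr (.inl i)) * u i)]

/-- The weight keeps the factors orthogonal, so only diagonal terms remain: `1 + d` for the factor
`1`, and `1 + (d - 1) + k_φ = d + k_φ` for a factor `u_j`. The first is no larger because `k_φ ≥ 1`.
-/
theorem IsBaseComponent.integral_weight_cholesky_le (hν : IsBaseComponent ν)
    (v : Param fam d) :
    ∫ u, (1 + ‖u‖ ^ 2) * ‖linReparam v u‖ ^ 2 ∂(baseLaw ν d) ≤ (d + kurtosis ν) * ‖v‖ ^ 2 := by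
  have hk := hν.one_le_kurtosis
  have hform : ∀ (a b : Option (Fin d)), (fun u : Vec d => (1 + ‖u‖ ^ 2) * (factor a u * factor b u))
      = fun u => factor a u * factor b u + ∑ l, u l ^ 2 * (factor a u * factor b u) := by
    intro a b
    funext u
    rw [EuclideanSpace.real_norm_sq_eq, add_mul, one_mul, Finset.sum_mul]
  have hsum : ∀ a b : Option (Fin d), Integrable
      (fun u : Vec d => ∑ l, u l ^ 2 * (factor a u * factor b u)) (baseLaw ν d) := fun a b =>
    integrable_finsetSum _ fun l _ => hν.integrable_sq_mul_factor_mul l a b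
  rw [integral_mul_norm_sq_linReparam, EuclideanSpace.real_norm_sq_eq, Finset.mul_sum]
  · refine Finset.sum_le_sum fun p _ => ?_
    rw [mul_comm]
    refine mul_le_mul_of_nonneg_right ?_ (sq_nonneg _)
    simp only [sq (factor _ _)]
    rw [hform, integral_add (hν.integrable_factor_mul _ _) (hsum _ _),
      integral_finsetSum _ fun l _ => hν.integrable_sq_mul_factor_mul l _ _]
    simp only [← sq (factor _ _), hν.integral_factor_sq]
    rcases colIdx p with _ | j
    · simp only [factor, one_pow, mul_one, hν.integral_apply_pow, hν.second]
      simp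
      linarith
    · simp only [factor]
      have hoff : ∀ l ∈ Finset.univ.erase j,
          ∫ u : Vec d, u l ^ 2 * u j ^ 2 ∂(baseLaw ν d) = 1 := fun l hl =>
        hν.integral_sq_mul_sq (Finset.ne_of_mem_erase hl)
      rw [← Finset.add_sum_erase _ _ (Finset.mem_univ j), Finset.sum_congr rfl hoff]
      have h4 : ∫ u : Vec d, u j ^ 2 * u j ^ 2 ∂(baseLaw ν d) = kurtosis ν := by
        simp only [← pow_add]
        exact hν.integral_apply_pow j 4
      have hd : 1 ≤ d := Nat.one_le_iff_ne_zero.2 fun h => by subst h; exact j.elim0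
      rw [h4, Finset.sum_const, Finset.card_erase_of_mem (Finset.mem_univ j), Finset.card_univ,
        Fintype.card_fin, nsmul_eq_mul, Nat.cast_sub hd]
      push_cast
      linarith
  · intro a b
    rw [hform]
    exact (hν.integrable_factor_mul a b).add (hsum a b)
  · intro a b hab
    rw [hform, integral_add (hν.integrable_factor_mul _ _) (hsum _ _),
      integral_finsetSum _ fun l _ => hν.integrable_sq_mul_factor_mul l _ _,
      hν.integral_factor_mul hab]
    simp [hν.integral_sq_mul_factor_mul _ hab]

theorem sum_pow_four_le (u : Vec d) : ∑ i, u i ^ 4 ≤ ‖u‖ ^ 4 := by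
  have h := Finset.sum_sq_le_sq_sum_of_nonneg (s := Finset.univ) (f := fun i => u i ^ 2)
    fun i _ => sq_nonneg _
  rw [← EuclideanSpace.real_norm_sq_eq] at h
  simpa only [← pow_mul] using h

theorem IsBaseComponent.integrable_weight (hν : IsBaseComponent ν) {Q : Vec d → ℝ}
    (hQ : Measurable Q) (h0 : ∀ u, 0 ≤ Q u) (h : ∀ u, Q u ≤ 1 + ‖u‖ ^ 2) (v : Param fam d) :
    Integrable (fun u => Q u * ‖linReparam v u‖ ^ 2) (baseLaw ν d) := by
  refine hν.integrable_of_le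
    (hQ.mul ((measurable_linReparam v).norm.pow_const 2)).aestronglyMeasurable
    ((Fintype.card (Idx fam d) * ‖v‖) ^ 2) fun u => ?_
  rw [abs_of_nonneg (mul_nonneg (h0 u) (sq_nonneg _))]
  have h1 : Q u ≤ (1 + ‖u‖) ^ 2 := (h u).trans (by nlinarith [norm_nonneg u])
  calc Q u * ‖linReparam v u‖ ^ 2
      ≤ (1 + ‖u‖) ^ 2 * (Fintype.card (Idx fam d) * ‖v‖ * (1 + ‖u‖)) ^ 2 := by
        gcongr
        exact norm_linReparam_le v u
    _ = _ := by ring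

theorem IsBaseComponent.integral_weight_meanField_le (hν : IsBaseComponent ν) (hd : 1 ≤ d)
    (v : Param .meanField d) :
    ∫ u, (1 + √(∑ i, u i ^ 4)) * ‖linReparam v u‖ ^ 2 ∂(baseLaw ν d) ≤
      (2 * kurtosis ν * √d + 1) * ‖v‖ ^ 2 := by
  have hprob := hν.isProbabilityMeasure_baseLaw (d := d)
  have hk := hν.one_le_kurtosis
  set r := √(d : ℝ) with hr
  have hr1 : 1 ≤ r := Real.one_le_sqrt.2 (by exact_mod_cast hd)
  have hr0 : 0 < r := by linarith
  have hrd : r ^ 2 = d := Real.sq_sqrt (by positivity)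
  have hi4 : ∀ i : Fin d, Integrable (fun u : Vec d => u i ^ 4) (baseLaw ν d) := fun i =>
    hν.integrable_apply_pow i le_rfl
  have hiS : Integrable (fun u : Vec d => ∑ i, u i ^ 4) (baseLaw ν d) :=
    integrable_finsetSum _ fun i _ => hi4 i
  have hS : ∫ u : Vec d, ∑ i, u i ^ 4 ∂(baseLaw ν d) = r ^ 2 * kurtosis ν := by
    rw [integral_finsetSum _ fun i _ => hi4 i, hrd]
    simp only [hν.integral_apply_pow]
    simp [kurtosis]
  have hi4' : ∀ c : Option (Fin d), Integrable (fun u => factor c u ^ 4) (baseLaw ν d) := by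
    intro c
    rcases c with _ | j
    · simp [factor]
    · exact hi4 j
  have h4 : ∀ c : Option (Fin d), ∫ u, factor c u ^ 4 ∂(baseLaw ν d) ≤ kurtosis ν := by
    intro c
    rcases c with _ | j
    · simpa [factor] using hk
    · exact (hν.integral_apply_pow j 4).le
  -- With `W` the root and `f` a factor, `2 W f² ≤ W² / r + r f⁴`. The choice `r = √d` balances the
  -- expectations: `𝔼 W² = d k_φ` and `𝔼 f⁴ ≤ k_φ`, for a total of at most `2 k_φ √d`.
  have hpt : ∀ u : Vec d, √(∑ i, u i ^ 4) * ‖linReparam v u‖ ^ 2 ≤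
      ∑ p : Idx .meanField d, v p ^ 2 *
        ((∑ i, u i ^ 4) / r + r * factor (colIdx p) u ^ 4) := by
    intro u
    have hW := Real.sqrt_nonneg (∑ i, u i ^ 4)
    have hW2 : √(∑ i, u i ^ 4) ^ 2 = ∑ i, u i ^ 4 :=
      Real.sq_sqrt (Finset.sum_nonneg fun i _ => by positivity)
    set W := √(∑ i, u i ^ 4) with hWdef
    calc W * ‖linReparam v u‖ ^ 2
        ≤ W * (2 * ∑ p : Idx .meanField d, v p ^ 2 * factor (colIdx p) u ^ 2) :=
          mul_le_mul_of_nonneg_left (norm_sq_linReparam_meanField_le v u) hW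
      _ = ∑ p : Idx .meanField d, v p ^ 2 * (2 * W * factor (colIdx p) u ^ 2) := by
          rw [← mul_assoc, Finset.mul_sum]
          exact Finset.sum_congr rfl fun p _ => by ring
      _ ≤ _ := by
          refine Finset.sum_le_sum fun p _ => mul_le_mul_of_nonneg_left ?_ (sq_nonneg _)
          rw [← hW2]
          have : W ^ 2 / r + r * factor (colIdx p) u ^ 4 - 2 * W * factor (colIdx p) u ^ 2 =
              (W - r * factor (colIdx p) u ^ 2) ^ 2 / r := by
            field_simp
            ring
          have h2 : 0 ≤ (W - r * factor (colIdx p) u ^ 2) ^ 2 / r := by positivity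
          linarith
  have hiterm : ∀ p : Idx .meanField d, Integrable (fun u : Vec d => v p ^ 2 *
      ((∑ i, u i ^ 4) / r + r * factor (colIdx p) u ^ 4)) (baseLaw ν d) := fun p =>
    ((hiS.div_const r).add ((hi4' _).const_mul r)).const_mul _
  have hnn : ∀ u : Vec d, 0 ≤ √(∑ i, u i ^ 4) := fun u => Real.sqrt_nonneg _
  have hmeas : Measurable fun u : Vec d => √(∑ i, u i ^ 4) :=
    Continuous.measurable (by fun_prop)
  have hle : ∀ u : Vec d, √(∑ i, u i ^ 4) ≤ ‖u‖ ^ 2 := by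
    intro u
    rw [Real.sqrt_le_left (by positivity), ← pow_mul]
    exact sum_pow_four_le u
  have hiW : Integrable (fun u => √(∑ i, u i ^ 4) * ‖linReparam v u‖ ^ 2) (baseLaw ν d) :=
    hν.integrable_weight hmeas hnn (fun u => (hle u).trans (by linarith)) v
  simp only [add_mul, one_mul]
  rw [integral_add (hν.integrable_norm_sq_linReparam v) hiW, hν.integral_norm_sq_linReparam]
  have h5 := integral_mono hiW (integrable_finsetSum Finset.univ fun p _ => hiterm p) hpt
  rw [integral_finsetSum _ fun p _ => hiterm p] at h5
  have h6 : ∑ p : Idx .meanField d, ∫ u : Vec d, v p ^ 2 *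
      ((∑ i, u i ^ 4) / r + r * factor (colIdx p) u ^ 4) ∂(baseLaw ν d) ≤
      2 * kurtosis ν * r * ‖v‖ ^ 2 := by
    rw [EuclideanSpace.real_norm_sq_eq, Finset.mul_sum]
    refine Finset.sum_le_sum fun p _ => ?_
    rw [integral_const_mul, integral_add (hiS.div_const r) ((hi4' _).const_mul r),
      integral_div, integral_const_mul, hS, mul_comm]
    refine mul_le_mul_of_nonneg_right ?_ (sq_nonneg _)
    have h7 : r ^ 2 * kurtosis ν / r = kurtosis ν * r := by field_simp
    have h8 := mul_le_mul_of_nonneg_left (h4 (colIdx p)) hr0.le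
    rw [h7]
    linarith
  linarith

theorem IsBaseComponent.varConst_pos (hν : IsBaseComponent ν) : 0 < varConst fam d ν := by
  have hk := hν.one_le_kurtosis
  cases fam
  · simp only [varConst]; positivity
  · simp only [varConst]; positivity

/-- The second moment of the reparameterization gradient grows with the distance of the
parameters to the constant reparameterization at a minimizer. -/
theorem IsBaseComponent.integral_norm_sq_adjReparam_le (hν : IsBaseComponent ν) (hd : 1 ≤ d)
    {L : ℝ} {ℓ : Vec d → ℝ} (hL : 0 ≤ L) (hℓ : IsSmooth L ℓ) {z : Vec d}
    (hz : z ∈ minimizers ℓ) (v : Param fam d) :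
    ∫ u, ‖(adjReparam (gradient ℓ (linReparam v u)) u : Param fam d)‖ ^ 2 ∂(baseLaw ν d) ≤
      varConst fam d ν * L ^ 2 * ‖v - constParam z‖ ^ 2 := by
  have hint : Integrable (fun u => ‖(adjReparam (gradient ℓ (linReparam v u)) u : Param fam d)‖ ^ 2)
      (baseLaw ν d) := by
    simp only [EuclideanSpace.real_norm_sq_eq]
    exact integrable_finsetSum _ fun p _ => hν.integrable_adjReparam_sq hL hℓ v p
  -- The weight `Q` is the only place where the two families differ: `1 + ‖u‖²` for Cholesky and `1
  -- + √(∑ u_i⁴)` for mean-field.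
  have key : ∀ Q : Vec d → ℝ, Measurable Q → (∀ u, 0 ≤ Q u) → (∀ u, Q u ≤ 1 + ‖u‖ ^ 2) →
      (∀ g u, ‖(adjReparam g u : Param fam d)‖ ^ 2 ≤ Q u * ‖g‖ ^ 2) →
      (∫ u, Q u * ‖linReparam (v - constParam z) u‖ ^ 2 ∂(baseLaw ν d) ≤
        varConst fam d ν * ‖v - constParam z‖ ^ 2) →
      ∫ u, ‖(adjReparam (gradient ℓ (linReparam v u)) u : Param fam d)‖ ^ 2 ∂(baseLaw ν d) ≤
        varConst fam d ν * L ^ 2 * ‖v - constParam z‖ ^ 2 := by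
    intro Q hQm hQ0 hQ hadj hQint
    have hi := hν.integrable_weight hQm hQ0 hQ (v - constParam z)
    have h1 := integral_mono hint (hi.const_mul (L ^ 2)) fun u => by
      refine (hadj _ u).trans ?_
      have h2 := pow_le_pow_left₀ (norm_nonneg _) (hℓ.norm_gradient_linReparam_le hz v u) 2
      have h3 := mul_le_mul_of_nonneg_left h2 (hQ0 u)
      refine h3.trans_eq ?_
      ring
    rw [integral_const_mul] at h1
    have := mul_le_mul_of_nonneg_left hQint (sq_nonneg L)
    linarith
  cases fam with
  | cholesky =>
    exact key (fun u => 1 + ‖u‖ ^ 2) (by fun_prop) (fun u => by positivity) (fun u => le_rfl)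
      norm_sq_adjReparam_le (hν.integral_weight_cholesky_le _)
  | meanField =>
    refine key (fun u => 1 + √(∑ i, u i ^ 4)) (Continuous.measurable (by fun_prop))
      (fun u => by positivity) (fun u => ?_)
      norm_sq_adjReparam_meanField_le (hν.integral_weight_meanField_le hd _)
    have : √(∑ i, u i ^ 4) ≤ ‖u‖ ^ 2 := by
      rw [Real.sqrt_le_left (by positivity), ← pow_mul]
      exact sum_pow_four_le u
    linarith

/-! ### The objective controls the distance of the samples to the minimizer -/

theorem IsBaseComponent.isProbabilityMeasure_variational (hν : IsBaseComponent ν) {φ : ℝ → ℝ}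
    (hφ : Continuous φ) (l : Param fam d) : IsProbabilityMeasure (variational φ ν l) := by
  have := hν.isProbabilityMeasure_baseLaw (d := d)
  exact Measure.isProbabilityMeasure_map (measurable_reparam hφ l).aemeasurable

theorem IsBaseComponent.integrable_negLogJoint (hν : IsBaseComponent ν) {L Lφ : ℝ} {φ : ℝ → ℝ}
    {lik prior : Vec d → ℝ} (hφ : IsConditioner Lφ φ)
    (hℓ : IsSmooth L (negLogJoint lik prior)) (l : Param fam d) :
    Integrable (negLogJoint lik prior) (variational φ ν l) := by
  rw [variational, integrable_map_measure hℓ.1.continuous.aestronglyMeasurable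
    (measurable_reparam hφ.differentiable.continuous l).aemeasurable]
  refine (hν.integrable_comp_linReparam hℓ (conditioned φ l)).congr
    (Filter.Eventually.of_forall fun u => ?_)
  simp only [Function.comp, reparam_eq_linReparam]

theorem integrable_prior {lik prior : Vec d → ℝ} (hm : IsModel lik prior) :
    Integrable prior := by
  by_contra h
  have := hm.prior_integral
  rw [integral_undef h] at this
  exact zero_ne_one this

/-- The likelihood ratio of a probability density has expectation at most one. -/
theorem integrable_div_rnDeriv {lik prior : Vec d → ℝ} (hm : IsModel lik prior)
    (q : Measure (Vec d)) [IsProbabilityMeasure q] (hq : q ≪ volume) :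
    Integrable (fun z => prior z / (q.rnDeriv volume z).toReal) q ∧
      ∫ z, prior z / (q.rnDeriv volume z).toReal ∂q ≤ 1 := by
  have hmeas : Measurable fun z => prior z / (q.rnDeriv volume z).toReal :=
    hm.measurable_prior.div (Measure.measurable_rnDeriv q volume).ennreal_toReal
  have h0 : ∀ z, 0 ≤ prior z / (q.rnDeriv volume z).toReal := fun z =>
    div_nonneg (hm.prior_pos z).le ENNReal.toReal_nonneg
  have hle : ∫⁻ z, ENNReal.ofReal (prior z / (q.rnDeriv volume z).toReal) ∂q ≤ 1 := by
    rw [← lintegral_rnDeriv_mul hq hmeas.ennreal_ofReal.aemeasurable]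
    calc _ ≤ ∫⁻ z, ENNReal.ofReal (prior z) := by
          -- Only an inequality: where the density of `q` is zero or infinite, the left-hand side
          -- vanishes by convention.
          refine lintegral_mono fun z => ?_
          rcases eq_or_ne (q.rnDeriv volume z) ⊤ with h | h
          · simp [h]
          rcases eq_or_ne (q.rnDeriv volume z) 0 with h' | h'
          · simp [h']
          have hpos : 0 < (q.rnDeriv volume z).toReal := ENNReal.toReal_pos h' h
          nth_rewrite 1 [← ENNReal.ofReal_toReal h]
          rw [← ENNReal.ofReal_mul hpos.le, mul_div_cancel₀ _ hpos.ne']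
      _ = 1 := by
          rw [← ofReal_integral_eq_lintegral_ofReal (integrable_prior hm)
            (Filter.Eventually.of_forall fun z => (hm.prior_pos z).le), hm.prior_integral,
            ENNReal.ofReal_one]
  refine ⟨⟨hmeas.aestronglyMeasurable, ?_⟩, ?_⟩
  · rw [hasFiniteIntegral_iff_ofReal (Filter.Eventually.of_forall h0)]
    exact hle.trans_lt ENNReal.one_lt_top
  · rw [integral_eq_lintegral_of_nonneg_ae (Filter.Eventually.of_forall h0)
      hmeas.aestronglyMeasurable]
    exact ENNReal.toReal_le_of_le_ofReal zero_le_one (by simpa using hle)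

/-- This moves the centre from the minimizer set to the single point `z₀`: the distance to the set
is at least `‖z - z₀‖ - Δ`, and `(a + Δ)² ≤ 2a² + 2Δ²` halves the constant. -/
theorem QuadraticGrowth.norm_sub_sq_le {μ Δ : ℝ} {f : Vec d → ℝ} (hq : QuadraticGrowth μ f)
    {z₀ : Vec d} (hΔ : ∀ z ∈ minimizers f, ‖z₀ - z‖ ≤ Δ) (z : Vec d) :
    μ / 4 * ‖z - z₀‖ ^ 2 - μ / 2 * Δ ^ 2 ≤ f z - ⨅ w, f w := by
  obtain ⟨s, hs⟩ := hq.nonempty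
  have hΔ0 : 0 ≤ Δ := (norm_nonneg _).trans (hΔ s hs)
  have h1 : ‖z - z₀‖ - Δ ≤ Metric.infDist z (minimizers f) := by
    refine (Metric.le_infDist hq.nonempty).2 fun y hy => ?_
    rw [dist_eq_norm]
    have := norm_sub_le_norm_sub_add_norm_sub z y z₀
    have h2 := hΔ y hy
    rw [norm_sub_rev] at h2
    linarith
  have h2 : (0 : ℝ) ≤ Metric.infDist z (minimizers f) := Metric.infDist_nonneg
  have h3 : ‖z - z₀‖ ^ 2 ≤ 2 * Metric.infDist z (minimizers f) ^ 2 + 2 * Δ ^ 2 := by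
    have h4 : ‖z - z₀‖ ^ 2 ≤ (Metric.infDist z (minimizers f) + Δ) ^ 2 :=
      pow_le_pow_left₀ (norm_nonneg _) (by linarith) 2
    nlinarith [sq_nonneg (Metric.infDist z (minimizers f) - Δ)]
  have h5 := hq.growth z
  have := mul_le_mul_of_nonneg_left h3 hq.pos.le
  linarith

/-- The objective is `𝔼 ℓ_like` plus a Kullback–Leibler divergence to the prior. Dropping the
divergence, which is nonnegative, leaves quadratic growth in expectation; the isometry evaluates
`𝔼‖z - z₀‖²` as a squared parameter distance. -/
theorem IsBaseComponent.norm_conditioned_sub_sq_le (hν : IsBaseComponent ν) {L Lφ μ Δ : ℝ}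
    {φ : ℝ → ℝ} {lik prior : Vec d → ℝ} (hφ : IsConditioner Lφ φ) (hm : IsModel lik prior)
    (hℓ : IsSmooth L (negLogJoint lik prior)) (hq : QuadraticGrowth μ (negLogLik lik))
    {z₀ : Vec d} (hΔ : ∀ z ∈ minimizers (negLogLik lik), ‖z₀ - z‖ ≤ Δ) (l : Param fam d) :
    μ / 4 * ‖conditioned φ l - constParam z₀‖ ^ 2 - μ / 2 * Δ ^ 2 ≤
      negELBO φ ν lik prior l - ⨅ z, negLogLik lik z := by
  have hprob := hν.isProbabilityMeasure_variational hφ.differentiable.continuous l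
  have hac := hν.variational_absolutelyContinuous hφ l
  have hmeas := measurable_reparam hφ.differentiable.continuous l
  obtain ⟨hri, hr1⟩ := integrable_div_rnDeriv hm (variational φ ν l) hac
  have hj := hν.integrable_negLogJoint hφ hℓ l
  have he := (hν.hasFiniteEntropy_variational hφ l).2
  have hsq : ∫ z, ‖z - z₀‖ ^ 2 ∂(variational φ ν l) = ‖conditioned φ l - constParam z₀‖ ^ 2 := by
    rw [variational, integral_map hmeas.aemeasurable (by fun_prop),
      ← hν.integral_norm_sq_linReparam]
    simp only [linReparam_sub, linReparam_constParam, reparam_eq_linReparam]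
  have hsqi : Integrable (fun z => ‖z - z₀‖ ^ 2) (variational φ ν l) := by
    rw [variational, integrable_map_measure (by fun_prop) hmeas.aemeasurable]
    refine (hν.integrable_norm_sq_linReparam (conditioned φ l - constParam z₀)).congr
      (Filter.Eventually.of_forall fun u => ?_)
    simp only [linReparam_sub, linReparam_constParam, reparam_eq_linReparam, Function.comp]
  have hF : negELBO φ ν lik prior l =
      ∫ z, (negLogJoint lik prior z + logDensity (variational φ ν l) z) ∂(variational φ ν l) := by
    rw [integral_add hj he, negELBO, energy, entropicReg, diffEntropy, neg_neg]
  -- Nonnegativity of the divergence enters pointwise as `log x ≤ x - 1` with `x` the ratio of prior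
  -- to density. After integration the ratio contributes at most `1` and cancels the `+ 1`. This
  -- avoids integrability of `log prior` on its own.
  have hpt : ∀ᵐ z ∂(variational φ ν l),
      μ / 4 * ‖z - z₀‖ ^ 2 + ((⨅ z, negLogLik lik z) - μ / 2 * Δ ^ 2 + 1) ≤
        negLogJoint lik prior z + logDensity (variational φ ν l) z +
          prior z / ((variational φ ν l).rnDeriv volume z).toReal := by
    filter_upwards [Measure.rnDeriv_pos hac,
      hac.ae_le (Measure.rnDeriv_ne_top (variational φ ν l) volume)] with z h0 ht
    have hr := ENNReal.toReal_pos h0.ne' ht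
    have h1 := Real.log_le_sub_one_of_pos (div_pos (hm.prior_pos z) hr)
    rw [Real.log_div (hm.prior_pos z).ne' hr.ne'] at h1
    have h2 := hq.norm_sub_sq_le hΔ z
    rw [logDensity, negLogJoint, Real.log_mul (hm.lik_pos z).ne' (hm.prior_pos z).ne']
    rw [negLogLik] at h2
    linarith
  have hint := integral_mono_ae ((hsqi.const_mul (μ / 4)).add (integrable_const _))
    ((hj.add he).add hri) hpt
  have e1 := integral_add (hsqi.const_mul (μ / 4))
    (integrable_const ((⨅ z, negLogLik lik z) - μ / 2 * Δ ^ 2 + 1))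
  have e2 := integral_add (hj.add he) hri
  simp only [Pi.add_apply] at hint e1 e2
  rw [e1, e2, integral_const_mul, hsq, ← hF] at hint
  simp only [integral_const, probReal_univ, smul_eq_mul, one_mul] at hint
  linarith

/-! ### The smoothness constant -/

theorem IsSmooth.nonneg {L : ℝ} {E : Type*} [NormedAddCommGroup E] [InnerProductSpace ℝ E]
    [CompleteSpace E] [Nontrivial E] {f : E → ℝ} (hf : IsSmooth L f) : 0 ≤ L := by
  obtain ⟨x, y, hxy⟩ := exists_pair_ne E
  exact nonneg_of_mul_nonneg_left ((norm_nonneg _).trans (hf.2 x y))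
    (norm_pos_iff.2 (sub_ne_zero.2 hxy))

/-- If `L = 0`, then `ℓ` is constant, and since `ℓ_like` is bounded below the prior is bounded below
by a positive constant. It is then not integrable over `ℝᵈ` with `d ≥ 1`. -/
theorem IsSmooth.pos_of_isModel (hd : 1 ≤ d) {L μ : ℝ} {lik prior : Vec d → ℝ}
    (hm : IsModel lik prior) (hℓ : IsSmooth L (negLogJoint lik prior))
    (hq : QuadraticGrowth μ (negLogLik lik)) {z₀ : Vec d}
    (hz : z₀ ∈ minimizers (negLogJoint lik prior)) : 0 < L := by
  have : Nonempty (Fin d) := ⟨⟨0, hd⟩⟩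
  refine hℓ.nonneg.lt_of_ne fun h0 => ?_
  have hconst : ∀ z, negLogJoint lik prior z = negLogJoint lik prior z₀ := by
    intro z
    have h := hℓ.abs_taylor_le z₀ (z - z₀)
    rw [gradient_eq_zero_of_mem_minimizers hz, inner_zero_left, ← h0, zero_div, zero_mul,
      add_sub_cancel, sub_zero] at h
    exact sub_eq_zero.1 (abs_nonpos_iff.1 h)
  set c := (⨅ w, negLogLik lik w) - negLogJoint lik prior z₀ with hc
  have hlow : ∀ z, Real.exp c ≤ prior z := by
    intro z
    rw [← Real.le_log_iff_exp_le (hm.prior_pos z)]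
    have h1 := hconst z
    have h2 := hq.growth z
    have h3 : 0 ≤ μ / 2 * Metric.infDist z (minimizers (negLogLik lik)) ^ 2 :=
      mul_nonneg (by linarith [hq.pos]) (sq_nonneg _)
    rw [negLogJoint, Real.log_mul (hm.lik_pos z).ne' (hm.prior_pos z).ne'] at h1
    rw [negLogLik] at h2
    linarith
  have hi : Integrable (fun _ : Vec d => Real.exp c) :=
    (integrable_prior hm).mono' aestronglyMeasurable_const
      (Filter.Eventually.of_forall fun z => by
        rw [Real.norm_of_nonneg (Real.exp_pos c).le]; exact hlow z)
  rw [integrable_const_iff] at hi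
  rcases hi with hi | hi
  · exact (Real.exp_pos c).ne' hi
  · have := hi.measure_univ_lt_top
    rw [measure_univ_of_isAddLeftInvariant] at this
    exact lt_irrefl _ this

/-! ### Moments of shifted sample means -/

theorem memLp_shifted_mean {α : Type*} [MeasurableSpace α] {P : Measure α}
    [IsProbabilityMeasure P] {f : α → ℝ} (hf : MemLp f 2 P) (M : ℕ) (h : ℝ) :
    MemLp (fun u : Fin M → α => (1 / (M : ℝ)) * ∑ m, f (u m) + h) 2
      (Measure.pi fun _ : Fin M => P) := by
  have h1 : ∀ m : Fin M, MemLp (fun u : Fin M → α => f (u m)) 2 (Measure.pi fun _ : Fin M => P) :=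
    fun m => hf.comp_measurePreserving (measurePreserving_eval (fun _ : Fin M => P) m)
  exact ((memLp_finsetSum Finset.univ fun m _ => h1 m).const_mul _).add (memLp_const h)

theorem integral_shifted_mean {α : Type*} [MeasurableSpace α] {P : Measure α}
    [IsProbabilityMeasure P] {f : α → ℝ} (hf : MemLp f 2 P) {M : ℕ} (hM : 1 ≤ M) (h : ℝ) :
    ∫ u : Fin M → α, ((1 / (M : ℝ)) * ∑ m, f (u m) + h) ∂(Measure.pi fun _ : Fin M => P) =
      ∫ x, f x ∂P + h := by
  have hfi : Integrable f P := hf.integrable one_le_two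
  have hi : ∀ m : Fin M, Integrable (fun u : Fin M → α => f (u m))
      (Measure.pi fun _ : Fin M => P) := fun m => integrable_comp_eval (μ := fun _ : Fin M => P) hfi
  have he : ∀ m : Fin M, ∫ u : Fin M → α, f (u m) ∂(Measure.pi fun _ : Fin M => P) =
      ∫ x, f x ∂P := fun m =>
    integral_comp_eval (μ := fun _ : Fin M => P) hfi.aestronglyMeasurable
  have hM0 : (M : ℝ) ≠ 0 := by positivity
  rw [integral_add ((integrable_finsetSum _ fun m _ => hi m).const_mul _) (integrable_const _),
    integral_const_mul, integral_finsetSum _ fun m _ => hi m]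
  simp [he]
  field_simp

/-- Squared mean plus variance: the deterministic shift drops out of the variance, and averaging `M`
independent copies divides it by `M`. -/
theorem integral_shifted_mean_sq_le {α : Type*} [MeasurableSpace α] {P : Measure α}
    [IsProbabilityMeasure P] {f : α → ℝ} (hf : MemLp f 2 P) {M : ℕ} (hM : 1 ≤ M) (h : ℝ) :
    ∫ u : Fin M → α, ((1 / (M : ℝ)) * ∑ m, f (u m) + h) ^ 2 ∂(Measure.pi fun _ : Fin M => P) ≤
      (∫ x, f x ∂P + h) ^ 2 + (1 / (M : ℝ)) * ∫ x, f x ^ 2 ∂P := by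
  have hM0 : (0 : ℝ) < M := by positivity
  have hZ := memLp_shifted_mean hf M h
  have hZ0 := memLp_shifted_mean hf M 0
  have h1 := variance_eq_sub hZ
  rw [integral_shifted_mean hf hM h] at h1
  simp only [add_zero] at hZ0
  rw [variance_add_const hZ0.aestronglyMeasurable, variance_const_mul] at h1
  have h2 := variance_sum_pi (μ := fun _ : Fin M => P) (X := fun _ => f) fun _ => hf
  have h3 : (∑ i : Fin M, fun ω : Fin M → α => f (ω i)) = fun ω => ∑ i, f (ω i) := by
    funext ω
    simp
  rw [h3] at h2
  rw [h2] at h1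
  have h4 := variance_le_expectation_sq hf.aestronglyMeasurable
  simp only [Finset.sum_const, Finset.card_univ, Fintype.card_fin, nsmul_eq_mul] at h1
  have h5 : (1 / (M : ℝ)) ^ 2 * (M * Var[f; P]) = (1 / (M : ℝ)) * Var[f; P] := by
    field_simp
  rw [h5] at h1
  simp only [Pi.pow_apply] at h1 h4
  have h6 := mul_le_mul_of_nonneg_left h4 (by positivity : 0 ≤ 1 / (M : ℝ))
  linarith

/-! ### The descent recursion -/

/-- A nonnegative sequence with multiplicative growth `1 + a`, additive growth `b` and decrease
`γ / 2 * r` has small `r` at some time before `T`. -/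
theorem exists_le_of_recursion {D r : ℕ → ℝ≥0∞} {δ γ a b ε : ℝ} {T : ℕ} (hδ : 0 < δ)
    (hγ : 0 < γ) (ha : 0 ≤ a) (hb : 0 ≤ b) (h0 : D 0 ≤ ENNReal.ofReal δ)
    (hrec : ∀ t, D (t + 1) + ENNReal.ofReal (γ / 2) * r t ≤
      ENNReal.ofReal (1 + a) * D t + ENNReal.ofReal b)
    (haT : a * T ≤ 1) (hbε : b ≤ γ * ε ^ 2 / 4) (hT : 12 * δ ≤ T * γ * ε ^ 2) :
    ∃ t < T, r t ≤ ENNReal.ofReal (ε ^ 2) := by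
  -- The recursion itself propagates finiteness from `D 0`, so no integrability along the run has to
  -- be assumed.
  have hDfin : ∀ t, D t ≠ ⊤ := by
    intro t
    induction t with
    | zero => exact ne_top_of_le_ne_top ENNReal.ofReal_ne_top h0
    | succ t ih =>
      refine ne_top_of_le_ne_top ?_ (le_self_add.trans (hrec t))
      exact ENNReal.add_ne_top.2 ⟨ENNReal.mul_ne_top ENNReal.ofReal_ne_top ih, ENNReal.ofReal_ne_top⟩
  have hrfin : ∀ t, r t ≠ ⊤ := by
    intro t h
    have h1 := le_add_self.trans (hrec t)
    rw [h, ENNReal.mul_top (by simpa using hγ)] at h1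
    exact ENNReal.add_ne_top.2 ⟨ENNReal.mul_ne_top ENNReal.ofReal_ne_top (hDfin t),
      ENNReal.ofReal_ne_top⟩ (top_le_iff.1 h1)
  by_contra! hcon
  have hreal : ∀ t, (D (t + 1)).toReal + γ / 2 * (r t).toReal ≤ (1 + a) * (D t).toReal + b := by
    intro t
    have h1 := ENNReal.toReal_mono (ENNReal.add_ne_top.2
      ⟨ENNReal.mul_ne_top ENNReal.ofReal_ne_top (hDfin t), ENNReal.ofReal_ne_top⟩) (hrec t)
    rw [ENNReal.toReal_add (hDfin _) (ENNReal.mul_ne_top ENNReal.ofReal_ne_top (hrfin t)),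
      ENNReal.toReal_add (ENNReal.mul_ne_top ENNReal.ofReal_ne_top (hDfin t))
        ENNReal.ofReal_ne_top, ENNReal.toReal_mul, ENNReal.toReal_mul,
      ENNReal.toReal_ofReal (by positivity), ENNReal.toReal_ofReal (by positivity),
      ENNReal.toReal_ofReal hb] at h1
    exact h1
  -- If `r t > ε²` throughout, each step loses `γ ε² / 2` and regains at most `b ≤ γ ε² / 4`.
  have hbound : ∀ t ≤ T, (D t).toReal ≤ (1 + a) ^ t * δ - t * (γ * ε ^ 2 / 4) := by
    intro t
    induction t with
    | zero =>
      intro _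
      simpa using ENNReal.toReal_le_of_le_ofReal hδ.le h0
    | succ t ih =>
      intro ht
      have h1 := ih (by omega)
      have h2 := hreal t
      have h3 : ε ^ 2 ≤ (r t).toReal := by
        have := ENNReal.toReal_mono (hrfin t) (hcon t (by omega)).le
        rwa [ENNReal.toReal_ofReal (sq_nonneg ε)] at this
      have h4 := mul_le_mul_of_nonneg_left h3 (by positivity : 0 ≤ γ / 2)
      have h5 := mul_le_mul_of_nonneg_left h1 (by positivity : 0 ≤ 1 + a)
      have h6 : 0 ≤ a * (t * (γ * ε ^ 2 / 4)) := by positivity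
      rw [pow_succ]
      push_cast
      nlinarith
  -- At time `T` the growth is at most `e < 3`, so `D T < 3 * δ - T * γ * ε ^ 2 / 4 ≤ 0`: this is
  -- the origin of the `12`.
  have h1 := hbound T le_rfl
  have h2 : (1 + a) ^ T ≤ Real.exp 1 := by
    calc (1 + a) ^ T ≤ Real.exp a ^ T :=
          pow_le_pow_left₀ (by positivity) (by linarith [Real.add_one_le_exp a]) T
      _ = Real.exp (a * T) := by rw [← Real.exp_nat_mul, mul_comm]
      _ ≤ Real.exp 1 := Real.exp_le_exp.2 haT
  have h3 := Real.exp_one_lt_d9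
  have h4 : (1 + a) ^ T * δ < 3 * δ := mul_lt_mul_of_pos_right (by linarith) hδ
  have h5 : (0 : ℝ) ≤ (D T).toReal := ENNReal.toReal_nonneg
  linarith

/-! ### Independence of iterates and fresh samples -/

variable {Ω : Type u} {φ : ℝ → ℝ} {lik prior : Vec d → ℝ} {M : ℕ} {γ : ℝ}

/-- Adaptedness: the iterate at time `t` only uses the samples drawn before `t`. The two sample
arrays may live on different spaces, so an iterate can be rewritten as a function of the past
samples alone. -/
theorem sgd_congr {Ω' : Type*} {U : ℕ → Fin M → Ω → Vec d} {U' : ℕ → Fin M → Ω' → Vec d}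
    {l₀ : Param fam d} {ω : Ω} {ω' : Ω'} (t : ℕ) (h : ∀ s < t, ∀ m, U s m ω = U' s m ω') :
    sgd φ ν lik prior γ U l₀ t ω = sgd φ ν lik prior γ U' l₀ t ω' := by
  induction t with
  | zero => rfl
  | succ t ih =>
    have h1 : (fun m => U t m ω) = fun m => U' t m ω' := funext fun m => h t t.lt_succ_self m
    simp only [sgd, ih fun s hs => h s (hs.trans t.lt_succ_self), h1]

/-- The stochastic gradient of the objective. -/
def stochGrad (φ : ℝ → ℝ) (ν : Measure ℝ) (lik prior : Vec d → ℝ) {M : ℕ} (l : Param fam d)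
    (u : Fin M → Vec d) : Param fam d :=
  reparamGrad φ lik prior u l + gradient (entropicReg φ ν) l

theorem measurable_sgd [MeasurableSpace Ω]
    (hg : Measurable fun x : Param fam d × (Fin M → Vec d) => stochGrad φ ν lik prior x.1 x.2)
    {U : ℕ → Fin M → Ω → Vec d} (hU : ∀ t m, Measurable (U t m)) (l₀ : Param fam d) (t : ℕ) :
    Measurable (sgd φ ν lik prior γ U l₀ t) := by
  induction t with
  | zero => exact measurable_const
  | succ t ih =>
    have h1 : Measurable fun ω => (sgd φ ν lik prior γ U l₀ t ω, fun m => U t m ω) :=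
      ih.prodMk (measurable_pi_lambda _ fun m => hU t m)
    exact ih.sub ((hg.comp h1).const_smul γ)

theorem IsIIDSamples.map_sgd_prodMk [MeasurableSpace Ω] {P : Measure Ω} [IsProbabilityMeasure P]
    {U : ℕ → Fin M → Ω → Vec d} {q : Measure (Vec d)} (hU : IsIIDSamples P U q)
    (hg : Measurable fun x : Param fam d × (Fin M → Vec d) => stochGrad φ ν lik prior x.1 x.2)
    (l₀ : Param fam d) (t : ℕ) :
    P.map (fun ω => (sgd φ ν lik prior γ U l₀ t ω, fun m => U t m ω)) =
      (P.map (sgd φ ν lik prior γ U l₀ t)).prod (Measure.pi fun _ : Fin M => q) := by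
  have hmU : Measurable fun ω => fun m => U t m ω := measurable_pi_lambda _ fun m => hU.measurable t m
  have hlaw : P.map (fun ω => fun m => U t m ω) = Measure.pi fun _ : Fin M => q := by
    have h1 : iIndepFun (fun m : Fin M => U t m) P :=
      hU.indep.precomp (g := fun m : Fin M => (t, m)) fun a b h => (Prod.ext_iff.1 h).2
    rw [(iIndepFun_iff_map_fun_eq_pi_map fun m => (hU.measurable t m).aemeasurable).1 h1]
    simp only [hU.law]
  set S : Finset (ℕ × Fin M) := Finset.range t ×ˢ Finset.univ with hS
  set S' : Finset (ℕ × Fin M) := {t} ×ˢ Finset.univ with hS'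
  have hdisj : Disjoint S S' := by
    rw [Finset.disjoint_left]
    rintro ⟨s, m⟩ h1 h2
    simp only [hS, hS', Finset.mem_product, Finset.mem_range, Finset.mem_singleton] at h1 h2
    omega
  have hind := hU.indep.indepFun_finset S S' hdisj fun p => hU.measurable p.1 p.2
  -- The past samples are completed to a full array by an arbitrary value; running SGD on it
  -- exhibits the iterate as a measurable function of the past.
  set ext : (S → Vec d) → ℕ → Fin M → Vec d := fun x s m =>
    if h : (s, m) ∈ S then x ⟨(s, m), h⟩ else 0 with hext
  set Φ : (S → Vec d) → Param fam d :=
    sgd φ ν lik prior γ (fun s m x => ext x s m) l₀ t with hΦ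
  have hΦm : Measurable Φ := by
    refine measurable_sgd hg (fun s m => ?_) l₀ t
    by_cases h : (s, m) ∈ S
    · simp only [hext, h, dif_pos]
      exact measurable_pi_apply _
    · simp only [hext, h, dif_neg, not_false_eq_true]
      exact measurable_const
  set Ψ : (S' → Vec d) → Fin M → Vec d := fun x m => x ⟨(t, m), by simp [hS']⟩ with hΨ
  have hΨm : Measurable Ψ := measurable_pi_lambda _ fun m => measurable_pi_apply _
  have hind2 := hind.comp hΦm hΨm
  have e1 : (Φ ∘ fun ω (i : S) => U i.1.1 i.1.2 ω) = sgd φ ν lik prior γ U l₀ t := by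
    funext ω
    refine sgd_congr t fun s hs m => ?_
    have h : (s, m) ∈ S := by simp [hS, hs]
    simp only [hext, h, dif_pos]
  have e2 : (Ψ ∘ fun ω (i : S') => U i.1.1 i.1.2 ω) = fun ω m => U t m ω := rfl
  rw [e1, e2] at hind2
  rw [(indepFun_iff_map_prod_eq_prod_map_map (measurable_sgd hg hU.measurable l₀ t).aemeasurable
    hmU.aemeasurable).1 hind2, hlaw]

/-- From a one-step expected descent inequality to approximate stationarity along the run. -/
theorem exists_integral_norm_gradient_le [MeasurableSpace Ω] {P : Measure Ω}
    [IsProbabilityMeasure P] {U : ℕ → Fin M → Ω → Vec d} {q : Measure (Vec d)}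
    [IsProbabilityMeasure q] (hU : IsIIDSamples P U q)
    (hg : Measurable fun x : Param fam d × (Fin M → Vec d) => stochGrad φ ν lik prior x.1 x.2)
    {F : Param fam d → ℝ} {Fs a b ε : ℝ} {T : ℕ} {l₀ : Param fam d} (hFc : Continuous F)
    (hGc : Continuous (gradient F)) (hFs : ∀ l, Fs ≤ F l) (hε : 0 ≤ ε)
    (hδ : 0 < F l₀ - Fs) (hγ : 0 < γ) (ha : 0 ≤ a) (hb : 0 ≤ b)
    (hstep : ∀ l, ∫⁻ x, ENNReal.ofReal (F (l - γ • stochGrad φ ν lik prior l x) - Fs)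
        ∂(Measure.pi fun _ : Fin M => q) + ENNReal.ofReal (γ / 2 * ‖gradient F l‖ ^ 2) ≤
      ENNReal.ofReal ((1 + a) * (F l - Fs) + b))
    (haT : a * T ≤ 1) (hbε : b ≤ γ * ε ^ 2 / 4) (hT : 12 * (F l₀ - Fs) ≤ T * γ * ε ^ 2) :
    ∃ t < T, Integrable (fun ω => ‖gradient F (sgd φ ν lik prior γ U l₀ t ω)‖) P ∧
      ∫ ω, ‖gradient F (sgd φ ν lik prior γ U l₀ t ω)‖ ∂P ≤ ε := by
  set X := sgd φ ν lik prior γ U l₀ with hX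
  have hXm : ∀ t, Measurable (X t) := fun t => measurable_sgd hg hU.measurable l₀ t
  -- Both sequences take values in `[0, ∞]`; integrability is read off only at the time `t` that the
  -- recursion provides.
  set D : ℕ → ℝ≥0∞ := fun t => ∫⁻ ω, ENNReal.ofReal (F (X t ω) - Fs) ∂P with hD
  set r : ℕ → ℝ≥0∞ := fun t => ∫⁻ ω, ENNReal.ofReal (‖gradient F (X t ω)‖ ^ 2) ∂P with hr
  have hFm : Measurable fun l => ENNReal.ofReal (F l - Fs) :=
    (hFc.measurable.sub_const Fs).ennreal_ofReal
  have hGm : Measurable fun l => ENNReal.ofReal (‖gradient F l‖ ^ 2) :=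
    (hGc.measurable.norm.pow_const 2).ennreal_ofReal
  have hrec : ∀ t, D (t + 1) + ENNReal.ofReal (γ / 2) * r t ≤
      ENNReal.ofReal (1 + a) * D t + ENNReal.ofReal b := by
    intro t
    have hstepm : Measurable fun x : Param fam d × (Fin M → Vec d) =>
        ENNReal.ofReal (F (x.1 - γ • stochGrad φ ν lik prior x.1 x.2) - Fs) :=
      hFm.comp (measurable_fst.sub (hg.const_smul γ))
    have h1 : D (t + 1) = ∫⁻ ω, ∫⁻ x, ENNReal.ofReal
        (F (X t ω - γ • stochGrad φ ν lik prior (X t ω) x) - Fs)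
          ∂(Measure.pi fun _ : Fin M => q) ∂P := by
      have e1 : D (t + 1) = ∫⁻ x, ENNReal.ofReal
          (F (x.1 - γ • stochGrad φ ν lik prior x.1 x.2) - Fs)
          ∂(P.map (fun ω => (X t ω, fun m => U t m ω))) := by
        rw [lintegral_map hstepm
          ((hXm t).prodMk (measurable_pi_lambda _ fun m => hU.measurable t m))]
        rfl
      rw [e1, hU.map_sgd_prodMk hg, lintegral_prod _ hstepm.aemeasurable,
        lintegral_map hstepm.lintegral_prod_right' (hXm t)]
    have h2 : ENNReal.ofReal (γ / 2) * r t =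
        ∫⁻ ω, ENNReal.ofReal (γ / 2 * ‖gradient F (X t ω)‖ ^ 2) ∂P := by
      have hGX : Measurable fun ω => ENNReal.ofReal (‖gradient F (X t ω)‖ ^ 2) :=
        hGm.comp (hXm t)
      simp only [hr]
      rw [← lintegral_const_mul _ hGX]
      refine lintegral_congr fun ω => ?_
      rw [ENNReal.ofReal_mul (by positivity)]
    have h3 : ENNReal.ofReal (1 + a) * D t + ENNReal.ofReal b =
        ∫⁻ ω, ENNReal.ofReal ((1 + a) * (F (X t ω) - Fs) + b) ∂P := by
      have h4 : ENNReal.ofReal b = ∫⁻ _, ENNReal.ofReal b ∂P := by simp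
      have hFX : Measurable fun ω => ENNReal.ofReal (F (X t ω) - Fs) := hFm.comp (hXm t)
      simp only [hD]
      rw [h4, ← lintegral_const_mul _ hFX, ← lintegral_add_right _ measurable_const]
      refine lintegral_congr fun ω => ?_
      have h5 : 0 ≤ F (X t ω) - Fs := sub_nonneg.2 (hFs _)
      rw [ENNReal.ofReal_add (by positivity) hb, ENNReal.ofReal_mul (by positivity)]
    rw [h1, h2, h3, ← lintegral_add_right]
    · exact lintegral_mono fun ω => hstep _
    · exact ((hGc.measurable.norm.pow_const 2).const_mul _).ennreal_ofReal.comp (hXm t)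
  obtain ⟨t, ht, hrt⟩ := exists_le_of_recursion (D := D) (r := r) hδ hγ ha hb
    (by simp [hD, hX, sgd]) hrec haT hbε hT
  have hm : Measurable fun ω => ‖gradient F (X t ω)‖ := (hGc.measurable.comp (hXm t)).norm
  have hsqi : Integrable (fun ω => ‖gradient F (X t ω)‖ ^ 2) P := by
    refine ⟨(hm.pow_const 2).aestronglyMeasurable, ?_⟩
    rw [hasFiniteIntegral_iff_ofReal (Filter.Eventually.of_forall fun ω => sq_nonneg _)]
    exact hrt.trans_lt ENNReal.ofReal_lt_top
  have hL2 : MemLp (fun ω => ‖gradient F (X t ω)‖) 2 P :=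
    (memLp_two_iff_integrable_sq hm.aestronglyMeasurable).2 hsqi
  refine ⟨t, ht, hL2.integrable one_le_two, ?_⟩
  have hsq : ∫ ω, ‖gradient F (X t ω)‖ ^ 2 ∂P ≤ ε ^ 2 := by
    rw [integral_eq_lintegral_of_nonneg_ae (Filter.Eventually.of_forall fun ω => sq_nonneg _)
      hsqi.aestronglyMeasurable]
    exact ENNReal.toReal_le_of_le_ofReal (sq_nonneg ε) hrt
  -- Nonnegative variance is Jensen's inequality here: the first moment is at most the root of the
  -- second.
  have hvar := variance_eq_sub hL2
  have hvar0 := variance_nonneg (fun ω => ‖gradient F (X t ω)‖) P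
  simp only [Pi.pow_apply] at hvar
  exact le_of_sq_le_sq (by linarith) hε

/-! ### The stochastic gradient -/

variable {L Lφ Ls LF μ Δ : ℝ}

/-- The reparameterization gradient in coordinates. -/
def coordGrad (φ : ℝ → ℝ) (ℓ : Vec d → ℝ) (l : Param fam d) (p : Idx fam d) (u : Vec d) : ℝ :=
  conditionedDeriv φ l p *
    (adjReparam (gradient ℓ (linReparam (conditioned φ l) u)) u : Param fam d) p

theorem IsSmooth.hasGradientAt_comp_reparam {ℓ : Vec d → ℝ} (hL : 0 ≤ L) (hℓ : IsSmooth L ℓ)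
    (hφ : IsConditioner Lφ φ) (l : Param fam d) (u : Vec d) :
    HasGradientAt (fun l' => ℓ (reparam φ l' u))
      (WithLp.toLp 2 fun p => coordGrad φ ℓ l p u) l := by
  simp only [reparam_eq_linReparam]
  refine hasGradientAt_comp_conditioned (f := fun v => ℓ (linReparam v u)) hφ.differentiable
    (hasGradientAt_of_abs_le (K := L / 2 * (Fintype.card (Idx fam d) * (1 + ‖u‖)) ^ 2) fun h => ?_)
  rw [linReparam_add, ← inner_linReparam]
  refine (hℓ.abs_taylor_le _ _).trans ?_
  have h1 := pow_le_pow_left₀ (norm_nonneg _) (norm_linReparam_le h u) 2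
  have h2 := mul_le_mul_of_nonneg_left h1 (by positivity : 0 ≤ L / 2)
  exact h2.trans_eq (by ring)

theorem stochGrad_apply (hL : 0 ≤ L) (hℓ : IsSmooth L (negLogJoint lik prior))
    (hφ : IsConditioner Lφ φ) (l : Param fam d) (x : Fin M → Vec d) (p : Idx fam d) :
    stochGrad φ ν lik prior l x p =
      (1 / (M : ℝ)) * ∑ m, coordGrad φ (negLogJoint lik prior) l p (x m) +
        gradient (entropicReg φ ν) l p := by
  simp only [stochGrad, reparamGrad, (hℓ.hasGradientAt_comp_reparam hL hφ l _).gradient]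
  simp [WithLp.ofLp_sum, Finset.sum_apply]

theorem continuous_conditionedDeriv (hφ : IsConditioner Lφ φ) (p : Idx fam d) :
    Continuous fun l : Param fam d => conditionedDeriv φ l p := by
  rcases p with i | i | q
  · exact continuous_const
  · exact hφ.differentiable_deriv.continuous.comp (PiLp.continuous_apply 2 _ _)
  · exact continuous_const

theorem continuous_coordGrad {ℓ : Vec d → ℝ} (hℓ : IsSmooth L ℓ) (hφ : IsConditioner Lφ φ)
    (p : Idx fam d) : Continuous fun x : Param fam d × Vec d => coordGrad φ ℓ x.1 p x.2 := by
  have h1 : Continuous fun x : Param fam d × Vec d => gradient ℓ (reparam φ x.1 x.2) :=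
    hℓ.continuous_gradient.comp (continuous_reparam hφ.differentiable.continuous)
  have h2 : Continuous fun x : Param fam d × Vec d =>
      gradient ℓ (linReparam (conditioned φ x.1) x.2) (rowIdx p) := by
    simp only [← reparam_eq_linReparam]
    exact (PiLp.continuous_apply 2 (fun _ : Fin d => ℝ) (rowIdx p)).comp h1
  exact ((continuous_conditionedDeriv hφ p).comp continuous_fst).mul
    (h2.mul ((continuous_factor _).comp continuous_snd))

theorem IsBaseComponent.measurable_stochGrad (hν : IsBaseComponent ν) (hL : 0 ≤ L)
    (hℓ : IsSmooth L (negLogJoint lik prior)) (hφ : IsConditioner Lφ φ) :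
    Measurable fun x : Param fam d × (Fin M → Vec d) => stochGrad φ ν lik prior x.1 x.2 := by
  have hc : Continuous fun x : Param fam d × (Fin M → Vec d) =>
      (WithLp.toLp 2 fun p => (1 / (M : ℝ)) *
        ∑ m, coordGrad φ (negLogJoint lik prior) x.1 p (x.2 m) +
        gradient (entropicReg φ ν) x.1 p : Param fam d) := by
    refine (PiLp.continuous_toLp 2 _).comp (continuous_pi fun p => ?_)
    refine (continuous_const.mul (continuous_finsetSum _ fun m _ => ?_)).add ?_
    · exact (continuous_coordGrad hℓ hφ p).comp
        (continuous_fst.prodMk ((continuous_apply m).comp continuous_snd))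
    · exact (PiLp.continuous_apply 2 (fun _ : Idx fam d => ℝ) p).comp
        ((hν.isSmooth_entropicReg hφ).continuous_gradient.comp continuous_fst)
  have he : ∀ x : Param fam d × (Fin M → Vec d), (WithLp.toLp 2 fun p => (1 / (M : ℝ)) *
        ∑ m, coordGrad φ (negLogJoint lik prior) x.1 p (x.2 m) +
        gradient (entropicReg φ ν) x.1 p : Param fam d) = stochGrad φ ν lik prior x.1 x.2 :=
    fun x => PiLp.ext fun p => (stochGrad_apply hL hℓ hφ x.1 x.2 p).symm
  simp only [he] at hc
  exact hc.measurable

theorem IsBaseComponent.memLp_coordGrad (hν : IsBaseComponent ν) {ℓ : Vec d → ℝ} (hL : 0 ≤ L)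
    (hℓ : IsSmooth L ℓ) (l : Param fam d) (p : Idx fam d) :
    MemLp (coordGrad φ ℓ l p) 2 (baseLaw ν d) := by
  refine MemLp.const_mul ?_ _
  refine (memLp_two_iff_integrable_sq ?_).2 (hν.integrable_adjReparam_sq hL hℓ _ p)
  exact (hℓ.continuous_adjReparam_gradient_apply _ p).aestronglyMeasurable

theorem hasGradientAt_add {E : Type*} [NormedAddCommGroup E] [InnerProductSpace ℝ E]
    [CompleteSpace E] {f g : E → ℝ} {f' g' x : E} (hf : HasGradientAt f f' x)
    (hg : HasGradientAt g g' x) : HasGradientAt (fun y => f y + g y) (f' + g') x := by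
  rw [hasGradientAt_iff_hasFDerivAt] at hf hg ⊢
  exact (hf.add hg).congr_fderiv (map_add _ _ _).symm

theorem IsBaseComponent.gradient_negELBO_apply (hν : IsBaseComponent ν) (hL : 0 ≤ L)
    (hℓ : IsSmooth L (negLogJoint lik prior)) (hφ : IsConditioner Lφ φ) (l : Param fam d)
    (p : Idx fam d) : gradient (negELBO φ ν lik prior) l p =
      ∫ u, coordGrad φ (negLogJoint lik prior) l p u ∂(baseLaw ν d) +
        gradient (entropicReg φ ν) l p := by
  have h1 := hν.hasGradientAt_energy hφ hL hℓ l
  have h2 := ((hν.isSmooth_entropicReg hφ).1 l).hasGradientAt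
  change gradient (fun l => energy φ ν lik prior l + entropicReg φ ν l) l p = _
  rw [(hasGradientAt_add h1 h2).gradient, PiLp.add_apply]
  congr 1
  simp only [coordGrad]
  rw [integral_const_mul]
  rfl

theorem IsBaseComponent.isSmooth_negELBO (hν : IsBaseComponent ν) (hL : 0 ≤ L)
    (hℓ : IsSmooth L (negLogJoint lik prior)) (hφ : IsConditioner Lφ φ)
    (hrot : RotationBound fam φ ν lik prior Ls) :
    IsSmooth (L + Lφ + Ls) (negELBO (fam := fam) φ ν lik prior) := by
  have h1 := hν.isSmooth_energy hφ hL hℓ hrot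
  have h2 := hν.isSmooth_entropicReg (fam := fam) (d := d) hφ
  have hg : ∀ l : Param fam d, gradient (negELBO φ ν lik prior) l =
      gradient (energy φ ν lik prior) l + gradient (entropicReg φ ν) l := fun l =>
    (hasGradientAt_add (h1.1 l).hasGradientAt (h2.1 l).hasGradientAt).gradient
  refine ⟨h1.1.add h2.1, fun l l' => ?_⟩
  rw [hg, hg, add_sub_add_comm]
  have e1 := h1.2 l l'
  have e2 := h2.2 l l'
  refine (norm_add_le _ _).trans ?_
  linarith

section Moments

variable (hν : IsBaseComponent ν) (hL : 0 ≤ L) (hℓ : IsSmooth L (negLogJoint lik prior))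
  (hφ : IsConditioner Lφ φ) (hM : 1 ≤ M)
include hν hL hℓ hφ

theorem memLp_stochGrad_apply (l : Param fam d) (p : Idx fam d) :
    MemLp (fun x : Fin M → Vec d => stochGrad φ ν lik prior l x p) 2
      (Measure.pi fun _ : Fin M => baseLaw ν d) := by
  have := hν.isProbabilityMeasure_baseLaw (d := d)
  simp only [stochGrad_apply hL hℓ hφ]
  exact memLp_shifted_mean (hν.memLp_coordGrad hL hℓ l p) M _

theorem integrable_norm_sq_stochGrad (l : Param fam d) :
    Integrable (fun x : Fin M → Vec d => ‖stochGrad φ ν lik prior l x‖ ^ 2)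
      (Measure.pi fun _ : Fin M => baseLaw ν d) := by
  simp only [EuclideanSpace.real_norm_sq_eq]
  exact integrable_finsetSum _ fun p _ => (memLp_stochGrad_apply hν hL hℓ hφ l p).integrable_sq

theorem integrable_inner_stochGrad (l w : Param fam d) :
    Integrable (fun x : Fin M → Vec d => ⟪w, stochGrad φ ν lik prior l x⟫_ℝ)
      (Measure.pi fun _ : Fin M => baseLaw ν d) := by
  have := hν.isProbabilityMeasure_baseLaw (d := d)
  simp only [PiLp.inner_apply, RCLike.inner_apply, conj_trivial]
  exact integrable_finsetSum _ fun p _ =>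
    ((memLp_stochGrad_apply hν hL hℓ hφ l p).integrable one_le_two).mul_const _

include hM

theorem integral_inner_stochGrad (l w : Param fam d) :
    ∫ x : Fin M → Vec d, ⟪w, stochGrad φ ν lik prior l x⟫_ℝ
      ∂(Measure.pi fun _ : Fin M => baseLaw ν d) =
      ⟪w, gradient (negELBO φ ν lik prior) l⟫_ℝ := by
  have := hν.isProbabilityMeasure_baseLaw (d := d)
  simp only [PiLp.inner_apply, RCLike.inner_apply, conj_trivial]
  rw [integral_finsetSum _ fun p _ =>
    ((memLp_stochGrad_apply hν hL hℓ hφ l p).integrable one_le_two).mul_const _]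
  refine Finset.sum_congr rfl fun p _ => ?_
  rw [integral_mul_const, hν.gradient_negELBO_apply hL hℓ hφ]
  simp only [stochGrad_apply hL hℓ hφ]
  rw [integral_shifted_mean (hν.memLp_coordGrad hL hℓ l p) hM]

/-- Coordinate by coordinate, the entropy gradient is a deterministic shift and the energy gradient
a sample mean; `|φ'| ≤ 1` reduces the second moment to the linear coordinates. -/
theorem integral_norm_sq_stochGrad_le (hd : 1 ≤ d) {z : Vec d}
    (hz : z ∈ minimizers (negLogJoint lik prior)) (l : Param fam d) :
    ∫ x : Fin M → Vec d, ‖stochGrad φ ν lik prior l x‖ ^ 2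
      ∂(Measure.pi fun _ : Fin M => baseLaw ν d) ≤
      ‖gradient (negELBO φ ν lik prior) l‖ ^ 2 +
        1 / (M : ℝ) * (varConst fam d ν * L ^ 2 * ‖conditioned φ l - constParam z‖ ^ 2) := by
  have hp := hν.isProbabilityMeasure_baseLaw (d := d)
  have hc := fun p => hν.memLp_coordGrad (φ := φ) hL hℓ l p
  have h1 : ∑ p, ∫ u, coordGrad φ (negLogJoint lik prior) l p u ^ 2 ∂(baseLaw ν d) ≤
      varConst fam d ν * L ^ 2 * ‖conditioned φ l - constParam z‖ ^ 2 := by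
    refine le_trans ?_ (hν.integral_norm_sq_adjReparam_le hd hL hℓ hz (conditioned φ l))
    simp only [EuclideanSpace.real_norm_sq_eq]
    rw [integral_finsetSum _ fun p _ => hν.integrable_adjReparam_sq hL hℓ _ p]
    refine Finset.sum_le_sum fun p _ => integral_mono (hc p).integrable_sq
      (hν.integrable_adjReparam_sq hL hℓ _ p) fun u => ?_
    simp only [coordGrad, mul_pow]
    have h := hφ.abs_conditionedDeriv_le l p
    exact mul_le_of_le_one_left (sq_nonneg _) ((sq_le_one_iff_abs_le_one _).2 h)
  have h2 : ∫ x : Fin M → Vec d, ‖stochGrad φ ν lik prior l x‖ ^ 2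
      ∂(Measure.pi fun _ : Fin M => baseLaw ν d) ≤
      ∑ p, (gradient (negELBO φ ν lik prior) l p ^ 2 + 1 / (M : ℝ) *
        ∫ u, coordGrad φ (negLogJoint lik prior) l p u ^ 2 ∂(baseLaw ν d)) := by
    simp only [EuclideanSpace.real_norm_sq_eq]
    rw [integral_finsetSum _ fun p _ => (memLp_stochGrad_apply hν hL hℓ hφ l p).integrable_sq]
    refine Finset.sum_le_sum fun p _ => ?_
    rw [hν.gradient_negELBO_apply hL hℓ hφ]
    simp only [stochGrad_apply hL hℓ hφ]
    exact integral_shifted_mean_sq_le (hc p) hM _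
  rw [Finset.sum_add_distrib, ← Finset.mul_sum, ← EuclideanSpace.real_norm_sq_eq] at h2
  have h3 := mul_le_mul_of_nonneg_left h1 (by positivity : 0 ≤ 1 / (M : ℝ))
  linarith

/-- The expected one-step descent of SGD on the objective. -/
theorem lintegral_step_le (hd : 1 ≤ d) (hm : IsModel lik prior)
    (hq : QuadraticGrowth μ (negLogLik lik)) {z : Vec d}
    (hz : z ∈ minimizers (negLogJoint lik prior))
    (hΔ : ∀ w ∈ minimizers (negLogLik lik), ‖z - w‖ ≤ Δ)
    (hF : IsSmooth LF (negELBO (fam := fam) φ ν lik prior)) (hLF : 0 ≤ LF) {Fs γ : ℝ}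
    (hFs : ∀ l : Param fam d, Fs ≤ negELBO φ ν lik prior l) (hγ : 0 < γ) (hγL : γ * LF ≤ 1)
    (l : Param fam d) :
    ∫⁻ x, ENNReal.ofReal (negELBO φ ν lik prior (l - γ • stochGrad φ ν lik prior l x) - Fs)
        ∂(Measure.pi fun _ : Fin M => baseLaw ν d) +
      ENNReal.ofReal (γ / 2 * ‖gradient (negELBO φ ν lik prior) l‖ ^ 2) ≤
      ENNReal.ofReal
        ((1 + 2 * (LF * L ^ 2 * varConst fam d ν / (μ * M)) * γ ^ 2) *
            (negELBO φ ν lik prior l - Fs) +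
          2 * (LF * L ^ 2 * varConst fam d ν / (μ * M)) * γ ^ 2 *
            (μ * Δ ^ 2 + (Fs - ⨅ w, negLogLik lik w))) := by
  have hp := hν.isProbabilityMeasure_baseLaw (d := d)
  set F : Param fam d → ℝ := negELBO φ ν lik prior with hFdef
  set Q := Measure.pi fun _ : Fin M => baseLaw ν d with hQ
  set G := gradient F l with hG
  have hM0 : (0 : ℝ) < M := by positivity
  have hμ := hq.pos
  have hC := hν.varConst_pos (fam := fam) (d := d)
  have hi1 := integrable_inner_stochGrad (M := M) hν hL hℓ hφ l G
  have hi2 := integrable_norm_sq_stochGrad (M := M) hν hL hℓ hφ l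
  have hpt : ∀ x : Fin M → Vec d, F (l - γ • stochGrad φ ν lik prior l x) - Fs ≤
      F l - Fs - γ * ⟪G, stochGrad φ ν lik prior l x⟫_ℝ +
        LF / 2 * γ ^ 2 * ‖stochGrad φ ν lik prior l x‖ ^ 2 := by
    intro x
    have h := (abs_le.1 (hF.abs_taylor_le l (-(γ • stochGrad φ ν lik prior l x)))).2
    rw [← sub_eq_add_neg, inner_neg_right, inner_smul_right, norm_neg, norm_smul, mul_pow,
      Real.norm_eq_abs, sq_abs] at h
    linarith
  have hiR0 : Integrable (fun x : Fin M → Vec d =>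
      F l - Fs - γ * ⟪G, stochGrad φ ν lik prior l x⟫_ℝ) Q :=
    (integrable_const _).sub (hi1.const_mul γ)
  have hiR : Integrable (fun x : Fin M → Vec d =>
      F l - Fs - γ * ⟪G, stochGrad φ ν lik prior l x⟫_ℝ +
        LF / 2 * γ ^ 2 * ‖stochGrad φ ν lik prior l x‖ ^ 2) Q :=
    hiR0.add (hi2.const_mul _)
  -- The quadratic majorant dominates a nonnegative quantity, so its lower integral is an ordinary
  -- integral. The integrability of `F` after the step is not needed.
  have hpos : ∀ x : Fin M → Vec d, 0 ≤ F l - Fs - γ * ⟪G, stochGrad φ ν lik prior l x⟫_ℝ +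
        LF / 2 * γ ^ 2 * ‖stochGrad φ ν lik prior l x‖ ^ 2 := fun x =>
    (sub_nonneg.2 (hFs _)).trans (hpt x)
  have hint : ∫ x, (F l - Fs - γ * ⟪G, stochGrad φ ν lik prior l x⟫_ℝ +
        LF / 2 * γ ^ 2 * ‖stochGrad φ ν lik prior l x‖ ^ 2) ∂Q =
      F l - Fs - γ * ‖G‖ ^ 2 + LF / 2 * γ ^ 2 * ∫ x, ‖stochGrad φ ν lik prior l x‖ ^ 2 ∂Q := by
    rw [integral_add hiR0 (hi2.const_mul _), integral_sub (integrable_const _) (hi1.const_mul γ),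
      integral_const_mul, integral_const_mul, integral_inner_stochGrad hν hL hℓ hφ hM,
      real_inner_self_eq_norm_sq]
    simp
  have h1 : ∫⁻ x, ENNReal.ofReal (F (l - γ • stochGrad φ ν lik prior l x) - Fs) ∂Q ≤
      ENNReal.ofReal (F l - Fs - γ * ‖G‖ ^ 2 +
        LF / 2 * γ ^ 2 * ∫ x, ‖stochGrad φ ν lik prior l x‖ ^ 2 ∂Q) := by
    rw [← hint, ofReal_integral_eq_lintegral_ofReal hiR (Filter.Eventually.of_forall hpos)]
    exact lintegral_mono fun x => ENNReal.ofReal_le_ofReal (hpt x)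
  refine (add_le_add_left h1 _).trans ?_
  rw [← ENNReal.ofReal_add (by rw [← hint]; exact integral_nonneg hpos) (by positivity)]
  refine ENNReal.ofReal_le_ofReal ?_
  have h2 := integral_norm_sq_stochGrad_le hν hL hℓ hφ hM hd hz l
  rw [← hFdef, ← hG] at h2
  have h3 := hν.norm_conditioned_sub_sq_le hφ hm hℓ hq hΔ l
  -- The noise is bounded by the suboptimality plus `R`. The term `μ / 2 * Δ ^ 2` is enlarged to `μ
  -- * Δ ^ 2` to match `R`.
  have h4 : ‖conditioned φ l - constParam z‖ ^ 2 ≤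
      4 / μ * (F l - Fs + (μ * Δ ^ 2 + (Fs - ⨅ w, negLogLik lik w))) := by
    have h5 : 0 ≤ μ / 2 * Δ ^ 2 := by positivity
    rw [div_mul_eq_mul_div, le_div_iff₀ hμ]
    linarith
  have h5 := mul_le_mul_of_nonneg_left h4
    (by positivity : 0 ≤ 1 / (M : ℝ) * (varConst fam d ν * L ^ 2))
  have h2' : ∫ x : Fin M → Vec d, ‖stochGrad φ ν lik prior l x‖ ^ 2 ∂Q ≤
      ‖G‖ ^ 2 + 1 / (M : ℝ) * (varConst fam d ν * L ^ 2) *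
        (4 / μ * (F l - Fs + (μ * Δ ^ 2 + (Fs - ⨅ w, negLogLik lik w)))) := by
    rw [← mul_assoc] at h2
    exact h2.trans (add_le_add le_rfl h5)
  have h6 := mul_le_mul_of_nonneg_left h2' (by positivity : 0 ≤ LF / 2 * γ ^ 2)
  have h7 : LF / 2 * γ ^ 2 * ‖G‖ ^ 2 ≤ γ / 2 * ‖G‖ ^ 2 := by
    have := mul_le_mul_of_nonneg_right hγL (by positivity : 0 ≤ γ / 2 * ‖G‖ ^ 2)
    linarith
  have h8 : LF / 2 * γ ^ 2 * (‖G‖ ^ 2 + 1 / (M : ℝ) * (varConst fam d ν * L ^ 2) *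
      (4 / μ * (F l - Fs + (μ * Δ ^ 2 + (Fs - ⨅ w, negLogLik lik w))))) =
      LF / 2 * γ ^ 2 * ‖G‖ ^ 2 + 2 * (LF * L ^ 2 * varConst fam d ν / (μ * M)) * γ ^ 2 *
        (F l - Fs + (μ * Δ ^ 2 + (Fs - ⨅ w, negLogLik lik w))) := by
    field_simp
    ring
  rw [h8] at h6
  linarith

end Moments

/-! ### Stationarity -/

theorem FindsStationary.mono {l₀ : Param fam d} {ε N N' : ℝ}
    (h : FindsStationary.{u} φ ν lik prior M l₀ ε N) (hN : N ≤ N') :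
    FindsStationary.{u} φ ν lik prior M l₀ ε N' := by
  obtain ⟨γ, hγ, h⟩ := h
  exact ⟨γ, hγ, fun Ω _ P _ U hU T hT hNT => h Ω P U hU T hT (hN.trans hNT)⟩

/-- The starting point already qualifies at `t = 0`, so any stepsize will do. It covers all
degenerate cases of the main theorem. -/
theorem findsStationary_of_norm_gradient_le {l₀ : Param fam d} {ε : ℝ} (N : ℝ)
    (h : ‖gradient (negELBO φ ν lik prior) l₀‖ ≤ ε) :
    FindsStationary.{u} φ ν lik prior M l₀ ε N := by
  refine ⟨1, one_pos, fun Ω _ P _ U _ T hT _ => ⟨0, by omega, ?_, ?_⟩⟩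
  · simp only [sgd]
    exact integrable_const _
  · simpa [sgd] using h

theorem findsStationary_of_le (hν : IsBaseComponent ν) (hL : 0 ≤ L)
    (hℓ : IsSmooth L (negLogJoint lik prior)) (hφ : IsConditioner Lφ φ) (hM : 1 ≤ M)
    (hd : 1 ≤ d) (hm : IsModel lik prior)
    (hq : QuadraticGrowth μ (negLogLik lik)) {z : Vec d}
    (hz : z ∈ minimizers (negLogJoint lik prior))
    (hΔ : ∀ w ∈ minimizers (negLogLik lik), ‖z - w‖ ≤ Δ)
    (hF : IsSmooth LF (negELBO (fam := fam) φ ν lik prior)) (hLF : 0 ≤ LF) {Fs δ R B ε : ℝ}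
    (hFs : ∀ l : Param fam d, Fs ≤ negELBO φ ν lik prior l) {l₀ : Param fam d}
    (hδ : 0 < δ) (hδeq : δ = negELBO φ ν lik prior l₀ - Fs)
    (hR : 0 ≤ R) (hReq : R = μ * Δ ^ 2 + (Fs - ⨅ w, negLogLik lik w))
    (hB : B = LF * L ^ 2 * varConst fam d ν / (μ * M)) (hε : 0 < ε) :
    FindsStationary.{u} φ ν lik prior M l₀ ε
      (288 * (δ ^ 2 * B / ε ^ 4 + δ * R * B / ε ^ 4 + δ * LF / ε ^ 2)) := by
  have hM0 : (0 : ℝ) < M := by positivity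
  have hμ := hq.pos
  have hC := hν.varConst_pos (fam := fam) (d := d)
  have hB0 : 0 ≤ B := by rw [hB]; positivity
  set N := 288 * (δ ^ 2 * B / ε ^ 4 + δ * R * B / ε ^ 4 + δ * LF / ε ^ 2) with hN
  -- The stepsize is tuned to the smallest admissible horizon, so it does not depend on `T`; a time
  -- found before `T₀` serves every longer run.
  set T₀ : ℕ := max 1 ⌈N⌉₊ with hT₀
  have hT1 : (1 : ℝ) ≤ T₀ := by exact_mod_cast le_max_left 1 ⌈N⌉₊
  have hTN : N ≤ T₀ := (Nat.le_ceil N).trans (by exact_mod_cast le_max_right 1 ⌈N⌉₊)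
  have hT0 : (0 : ℝ) < T₀ := by linarith
  -- This makes `T₀ * γ * ε ^ 2 = 12 * δ` exact. The other requirements, `a * T₀ ≤ 1`, `b ≤ γ * ε ^
  -- 2 / 4` and `γ * LF ≤ 1`, then become `t1`, `t2` and `t3`, with constants `288`, `96` and `12`.
  set γ := 12 * δ / (T₀ * ε ^ 2) with hγdef
  have hγ : 0 < γ := by positivity
  have n1 : 0 ≤ δ ^ 2 * B / ε ^ 4 := by positivity
  have n2 : 0 ≤ δ * R * B / ε ^ 4 := by positivity
  have n3 : 0 ≤ δ * LF / ε ^ 2 := by positivity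
  have t1 : 288 * (δ ^ 2 * B / ε ^ 4) ≤ T₀ := by linarith
  have t2 : 96 * (δ * R * B / ε ^ 4) ≤ T₀ := by linarith
  have t3 : 12 * (δ * LF / ε ^ 2) ≤ T₀ := by linarith
  have hγL : γ * LF ≤ 1 := by
    have : γ * LF = 12 * (δ * LF / ε ^ 2) / T₀ := by
      rw [hγdef]; field_simp
    rw [this]
    exact (div_le_one hT0).2 t3
  have hγT : γ * T₀ * ε ^ 2 = 12 * δ := by
    rw [hγdef]; field_simp
  have haT : 2 * B * γ ^ 2 * T₀ ≤ 1 := by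
    have : 2 * B * γ ^ 2 * T₀ = 288 * (δ ^ 2 * B / ε ^ 4) / T₀ := by
      rw [hγdef]; field_simp; ring
    rw [this]
    exact (div_le_one hT0).2 t1
  have hbε : 2 * B * γ ^ 2 * R ≤ γ * ε ^ 2 / 4 := by
    have h1 : 8 * B * γ * R = 96 * (δ * R * B / ε ^ 4) / T₀ * ε ^ 2 := by
      rw [hγdef]; field_simp; ring
    have h2 : 8 * B * γ * R ≤ ε ^ 2 := by
      rw [h1]
      exact mul_le_of_le_one_left (sq_nonneg ε) ((div_le_one hT0).2 t2)
    have := mul_le_mul_of_nonneg_left h2 hγ.le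
    linarith
  refine ⟨γ, hγ, fun Ω _ P _ U hU T hT hNT => ?_⟩
  have hTT : T₀ ≤ T := max_le hT (Nat.ceil_le.2 hNT)
  have hp := hν.isProbabilityMeasure_baseLaw (d := d)
  obtain ⟨t, ht, h⟩ := exists_integral_norm_gradient_le (φ := φ) (ν := ν) (lik := lik)
    (prior := prior) (γ := γ) (F := negELBO φ ν lik prior) (Fs := Fs) (a := 2 * B * γ ^ 2)
    (b := 2 * B * γ ^ 2 * R) (ε := ε) (T := T₀) (l₀ := l₀) hU
    (hν.measurable_stochGrad hL hℓ hφ) hF.1.continuous hF.continuous_gradient hFs hε.le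
    (hδeq ▸ hδ) hγ (by positivity) (by positivity)
    (fun l => by
      rw [hB, hReq]
      exact lintegral_step_le hν hL hℓ hφ hM hd hm hq hz hΔ hF hLF hFs hγ hγL l)
    haT hbε (by rw [← hδeq]; linarith)
  exact ⟨t, ht.trans_le hTT, h⟩

theorem subsingleton_param (fam : ScaleFamily) : Subsingleton (Param fam 0) :=
  ⟨fun _ _ => PiLp.ext fun p => (rowIdx p).elim0⟩

end

end BBVI

/-! ### The complexity bounds -/

theorem mainTheorem1 :
    ∃ K : ℝ, 0 < K ∧
      ∀ (fam : BBVI.ScaleFamily) (d : ℕ) (ν : MeasureTheory.Measure ℝ) (φ : ℝ → ℝ)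
        (lik prior : BBVI.Vec d → ℝ) (Ll Lφ Ls μ Δ : ℝ) (zJ : BBVI.Vec d) (M : ℕ)
        (l₀ : BBVI.Param fam d),
        BBVI.IsBaseComponent ν →
        BBVI.IsConditioner Lφ φ →
        BBVI.IsModel lik prior →
        BBVI.IsSmooth Ll (BBVI.negLogJoint lik prior) →
        BBVI.RotationBound fam φ ν lik prior Ls →
        BBVI.QuadraticGrowth μ (BBVI.negLogLik lik) →
        zJ ∈ BBVI.minimizers (BBVI.negLogJoint lik prior) →
        (∀ z ∈ BBVI.minimizers (BBVI.negLogLik lik), ‖zJ - z‖ ≤ Δ) →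
        1 ≤ M →
        let F : BBVI.Param fam d → ℝ := BBVI.negELBO φ ν lik prior
        let LF : ℝ := Ll + Lφ + Ls
        let C : ℝ := BBVI.varConst fam d ν
        let δ : ℝ := F l₀ - ⨅ l, F l
        let R : ℝ := μ * Δ ^ 2 + ((⨅ l, F l) - ⨅ z, BBVI.negLogLik lik z)
        -- the objective is well defined, bounded below and smooth
        (∀ l : BBVI.Param fam d,
          MeasureTheory.Integrable (BBVI.negLogJoint lik prior) (BBVI.variational φ ν l) ∧
          BBVI.HasFiniteEntropy (BBVI.variational φ ν l)) ∧
        BddBelow (Set.range F) ∧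
        BBVI.IsSmooth LF F ∧
        -- every accuracy, absolute constant, all lower-order terms displayed
        (∀ ε : ℝ, 0 < ε →
          BBVI.FindsStationary.{u} φ ν lik prior M l₀ ε
            (K * (δ ^ 2 * LF * Ll ^ 2 * C / (μ * M * ε ^ 4)
              + δ * R * LF * Ll ^ 2 * C / (μ * M * ε ^ 4) + δ * LF / ε ^ 2))) ∧
        -- small accuracies: only the leading rate, up to the factor `1 + R / δ`
        (∀ ε : ℝ, 0 < ε → ε ^ 2 ≤ δ * Ll ^ 2 * C / (μ * M) →
          BBVI.FindsStationary.{u} φ ν lik prior M l₀ ε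
            (K * (1 + R / δ) * (δ ^ 2 * LF * Ll ^ 2 * C / (μ * M * ε ^ 4)))) ∧
        -- every accuracy: only the leading rate, up to a factor that does not depend on it
        (∃ c : ℝ, 0 < c ∧ ∀ ε : ℝ, 0 < ε →
          BBVI.FindsStationary.{u} φ ν lik prior M l₀ ε
            (c * (δ ^ 2 * LF * Ll ^ 2 * C / (μ * M * ε ^ 4)))) := by
  -- Twice the `288` of `findsStationary_of_le`: for small `ε` the term `δ * LF / ε ^ 2` is absorbed
  -- into the leading one, which then counts twice.
  refine ⟨576, by norm_num, ?_⟩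
  intro fam d ν φ lik prior Ll Lφ Ls μ Δ zJ M l₀ hν hφ hm hℓ hrot hq hz hΔ hM F LF C δ R
  have hμ := hq.pos
  have hlow : ∀ l, (⨅ w, BBVI.negLogLik lik w) - μ / 2 * Δ ^ 2 ≤ F l := by
    intro l
    have h1 := hν.norm_conditioned_sub_sq_le hφ hm hℓ hq hΔ l
    have h2 : 0 ≤ μ / 4 * ‖BBVI.conditioned φ l - BBVI.constParam zJ‖ ^ 2 := by positivity
    linarith
  have hbdd : BddBelow (Set.range F) := ⟨_, Set.forall_mem_range.2 hlow⟩
  have hFs : ∀ l, (⨅ l, F l) ≤ F l := fun l => ciInf_le hbdd l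
  refine ⟨fun l => ⟨hν.integrable_negLogJoint hφ hℓ l, hν.hasFiniteEntropy_variational hφ l⟩,
    hbdd, ?_⟩
  rcases Nat.eq_zero_or_pos d with rfl | hd
  -- In dimension zero `Ll` may be negative, so this case cannot go through the general argument;
  -- all gradients vanish.
  · have hsub := BBVI.subsingleton_param fam
    have h0 : ∀ ε : ℝ, 0 < ε → ‖gradient F l₀‖ ≤ ε := fun ε hε => by
      rw [Subsingleton.elim (gradient F l₀) 0, norm_zero]
      exact hε.le
    refine ⟨⟨fun x => (hasFDerivAt_of_subsingleton F x).differentiableAt, fun x y => ?_⟩,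
      fun ε hε => BBVI.findsStationary_of_norm_gradient_le _ (h0 ε hε),
      fun ε hε _ => BBVI.findsStationary_of_norm_gradient_le _ (h0 ε hε),
      1, one_pos, fun ε hε => BBVI.findsStationary_of_norm_gradient_le _ (h0 ε hε)⟩
    rw [Subsingleton.elim x y, sub_self, sub_self, norm_zero, mul_zero]
  have hL : 0 < Ll := hℓ.pos_of_isModel hd hm hq hz
  have hLF : 0 < LF := by
    have h1 := hφ.nonneg
    have h2 := hrot.1
    positivity
  have hF : BBVI.IsSmooth LF F := hν.isSmooth_negELBO hL.le hℓ hφ hrot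
  have hC : 0 < C := hν.varConst_pos
  have hM0 : (0 : ℝ) < M := by positivity
  have hR : 0 ≤ R := by
    have h1 : (⨅ w, BBVI.negLogLik lik w) - μ / 2 * Δ ^ 2 ≤ ⨅ l, F l := le_ciInf hlow
    have h2 : 0 ≤ μ / 2 * Δ ^ 2 := by positivity
    change 0 ≤ μ * Δ ^ 2 + ((⨅ l, F l) - ⨅ z, BBVI.negLogLik lik z)
    linarith
  have hδ0 : 0 ≤ δ := sub_nonneg.2 (hFs l₀)
  refine ⟨hF, ?_⟩
  -- If `δ = 0`, the start is a global minimizer and its gradient is zero.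
  rcases hδ0.eq_or_lt with hδ | hδ
  · have hmin : l₀ ∈ BBVI.minimizers F := fun l => by
      have h1 : F l₀ = ⨅ l, F l := sub_eq_zero.1 hδ.symm
      rw [h1]
      exact hFs l
    have h0 : ∀ ε : ℝ, 0 < ε → ‖gradient F l₀‖ ≤ ε := fun ε hε => by
      rw [BBVI.gradient_eq_zero_of_mem_minimizers hmin, norm_zero]
      exact hε.le
    exact ⟨fun ε hε => BBVI.findsStationary_of_norm_gradient_le _ (h0 ε hε),
      fun ε hε _ => BBVI.findsStationary_of_norm_gradient_le _ (h0 ε hε),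
      1, one_pos, fun ε hε => BBVI.findsStationary_of_norm_gradient_le _ (h0 ε hε)⟩
  set V : ℝ := Ll ^ 2 * C / (μ * M) with hV
  have hVpos : 0 < V := by positivity
  have hcore : ∀ ε : ℝ, 0 < ε → BBVI.FindsStationary.{u} φ ν lik prior M l₀ ε
      (288 * (δ ^ 2 * (LF * V) / ε ^ 4 + δ * R * (LF * V) / ε ^ 4 + δ * LF / ε ^ 2)) :=
    fun ε hε => BBVI.findsStationary_of_le hν hL.le hℓ hφ hM hd hm hq hz hΔ hF hLF.le hFs hδ rfl
      hR rfl (by rw [hV, mul_div_assoc', mul_assoc]) hε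
  have e1 : ∀ ε : ℝ, δ ^ 2 * LF * Ll ^ 2 * C / (μ * M * ε ^ 4) = δ ^ 2 * (LF * V) / ε ^ 4 := by
    intro ε
    rw [hV]
    field_simp
  have e2 : ∀ ε : ℝ, δ * R * LF * Ll ^ 2 * C / (μ * M * ε ^ 4) = δ * R * (LF * V) / ε ^ 4 := by
    intro ε
    rw [hV]
    field_simp
  have e3 : ∀ ε : ℝ, 0 < ε → δ * R * (LF * V) / ε ^ 4 = R / δ * (δ ^ 2 * (LF * V) / ε ^ 4) := by
    intro ε hε
    field_simp
  have e4 : ∀ ε : ℝ, 0 < ε →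
      δ * LF / ε ^ 2 = ε ^ 2 / (δ * V) * (δ ^ 2 * (LF * V) / ε ^ 4) := by
    intro ε hε
    field_simp
  refine ⟨fun ε hε => (hcore ε hε).mono ?_, fun ε hε hsmall => (hcore ε hε).mono ?_, ?_⟩
  · rw [e1, e2]
    refine mul_le_mul_of_nonneg_right (by norm_num) (by positivity)
  · rw [e1, e3 ε hε, e4 ε hε]
    have h1 : ε ^ 2 / (δ * V) ≤ 1 := by
      refine (div_le_one (by positivity)).2 (hsmall.trans_eq ?_)
      rw [hV, mul_div_assoc', mul_assoc]
    have h2 : 0 ≤ δ ^ 2 * (LF * V) / ε ^ 4 := by positivity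
    have h3 := mul_le_mul_of_nonneg_right h1 h2
    have h4 : 0 ≤ R / δ * (δ ^ 2 * (LF * V) / ε ^ 4) := by positivity
    linarith
  -- Accuracies `ε ≥ G` hold at the start. For `ε < G` the ratio `ε² / (δ V)` of the lower-order
  -- term to the leading one is at most `G² / (δ V)`, which does not depend on `ε`.
  · set G := ‖gradient F l₀‖ with hG
    refine ⟨288 * (1 + R / δ + G ^ 2 / (δ * V)), by positivity, fun ε hε => ?_⟩
    rcases le_or_gt G ε with hGε | hGε
    · exact BBVI.findsStationary_of_norm_gradient_le _ hGε
    refine (hcore ε hε).mono ?_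
    rw [e1, e3 ε hε, e4 ε hε]
    have h1 : ε ^ 2 / (δ * V) ≤ G ^ 2 / (δ * V) := by gcongr
    have h2 : 0 ≤ δ ^ 2 * (LF * V) / ε ^ 4 := by positivity
    have h3 := mul_le_mul_of_nonneg_right h1 h2
    linarith
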